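/- **Theorem 2 (Shape Derivative).** *Setting.* Let $\mathcal T$ be a finite conforming triangulation in $\mathbb R^2$ with Lagrange elements of order $p\ge 1$, nodes $a_s$ and ansatz functions $N_s^p$. Let $x_l$ be a vertex whose piecewise linear hat function $N_l^1$, extended by zero, is continuous on $\mathbb R^2$ (i.e. $x_l$ is not on the outer boundary of the mesh). For $\delta x_l\in\mathbb R^2$ put $\vec V_l=\delta x_l N_l^1$, $\phi_\epsilon(x)=x+\epsilon\vec V_l(x)$, and for the open fluid domain $\Omega$ put $\Omega_\epsilon=\phi_\epsilon(\Omega)$. The ansatz functions move along with the deformation: on $\Omega_\epsilon$ they are $N_s^{p}\circ\phi_\epsilon^{-1}$. Let $d_\Omega$ be the signed distance to $\partial\Omega$ (positive in $\Omega$), let $h,\alpha>0$, $$\max\nolimits_\alpha(d)=\begin{cases}\frac\alpha4(1-\frac dh)^2+\frac12(1-\frac dh)+\frac1{4\alpha}&\text{if } |1-\frac dh|\le\frac1\alpha,\\ \max(0,1-\frac dh)&\text{otherwise,}\end{cases}$$ and $\gamma_\epsilon(x)=c\,\max_\alpha(d_{\Omega_\epsilon}(x))$ with a constant $c$ (reference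 density, or $1$), $\gamma=\gamma_0$. The nodal coefficients for $\Omega_\epsilon$ are $\gamma_s(\epsilon)=\gamma_\epsilon(a_s)$, sampled at the fixed points $a_s$; write $\gamma_s=\gamma_s(0)$. The boundary density is $\rho_D^\epsilon=\sum_s m(\gamma_s(\epsilon)+\gamma^L_s)\,N_s^p\circ\phi_\epsilon^{-1}$, with fixed outflow coefficients $\gamma_s^L$ that vanish at the nodes of the triangles containing $x_l$. *Particles.* There are $N$ particles of mass $m>0$, with velocities $u_k$ and positions $x_k$ in $\mathbb R^{2N}$, given by $u_k=u_{k-1}+\frac{\Delta t}{m}F^\epsilon(u_{k-1},x_{k-1})$, $x_k=x_{k-1}+\Delta t\,u_k$ for $1\le k\le n$, with $\Delta t>0$, from fixed $(u_0,x_0)$. The force on particle $i$ is $F^{\mathrm{fluid},i}(u,x)+\nabla\rho_D^\epsilon(x^i)$, the fluid part depending on the states only. The objective is $J_1(\Omega_\epsilon)=\sum_{k=1}^n J_{1,k}(x_k,u_k,\Omega_\epsilon)$ with states computed on $\Omega_\epsilon$. With $W(z,h)=\frac1{\pi h^2}e^{-\|z\|^2/h^2}$, a finite set $\Gamma_{1,h}$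 of shoreline points, a rest height $\bar H$ and $\rho_0>0$, $J_{1,k}$ is either of $$\sum_{y\in\Gamma_{1,h}}\tfrac{\Delta t}{2}\Big(\tfrac1{\rho_0}\sum_{j=1}^N mW(y-x_k^j,h)-\bar H(y)\Big)^2,\qquad \sum_{y\in\Gamma_{1,h}}\sum_{j=1}^N\tfrac{\Delta t}{2}\Big(\tfrac m{\rho_0}W(y-x_k^j,h)-\bar H(y)\Big)^2,$$ with $y$ replaced by $\phi_\epsilon(y)$ on $\Omega_\epsilon$; the shoreline is fixed, $\vec V_l=0$ on $\Gamma_{1,h}$. The adjoints are given on the unperturbed domain by $\mu_n=\nabla_{u_n}J_{1,n}$, $\delta_n=\nabla_{x_n}J_{1,n}$ and, for $1\le k<n$, $$\mu_k=\big(I+\tfrac{\Delta t}m F^{u_k}\big)^T(\mu_{k+1}+\Delta t\,\delta_{k+1})+\nabla_{u_k}J_{1,k},\qquad \delta_k=\delta_{k+1}+\big(\tfrac{\Delta t}m F^{x_k}\big)^T(\mu_{k+1}+\Delta t\,\delta_{k+1})+\nabla_{x_k}J_{1,k}.$$ *Regularity.* $F^{\mathrm{fluid}}$ is differentiable at the unperturbed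 states $(u_k,x_k)$, $0\le k<n$, and no $x_k^i$, $0\le k<n$, lies on an edge of the mesh. Call a point $x$ regular if $\max'_\alpha(d_\Omega(x))=0$, or if every closest boundary point $q$ of $x$ with $\vec V_l(q)\ne0$ is the only closest boundary point and $\partial\Omega$ has a unit normal at $q$. All nodes $a_s$ are regular. Below, $p_{\partial\Omega}(x)$ is a closest boundary point and $\vec n$ is the unit normal pointing into $\Omega$; if $\vec V_l(p_{\partial\Omega}(x))=0$, the product $\vec V_l\cdot\vec n$ there is read as $0$. *Claim.* The derivative $DJ_1(\Omega)[\vec V_l]=\frac{d}{d\epsilon}J_1(\Omega_\epsilon)|_{\epsilon=0^+}$ exists and $$\begin{aligned}DJ_1(\Omega)[\vec V_l]&=\frac{d}{d\epsilon}\sum_{k=1}^nJ_{1,k}(x_k,u_k,\Omega_\epsilon)\Big|_{\epsilon=0^+}+\frac{d}{d\epsilon}\sum_{k=1}^n(F^\epsilon_{k-1})^T\Big(\frac{\Delta t}m\mu_k+\frac{\Delta t^2}m\delta_k\Big)\Big|_{\epsilon=0^+}\\&=\sum_{k=1}^n\sum_{i=1}^N\big[B(x_{k-1}^i)\big]^T\big(\Delta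 t\,\mu_k^i+\Delta t^2\,\delta_k^i\big),\\ B(y)&=\nabla\Big(\sum_sD\gamma_s[\vec V_l]N_s^p\Big)(y)-(\nabla\vec V_l(y))^T\sum_s\gamma_s\nabla N_s^p(y)-\nabla\Big(\sum_s\gamma_s\nabla N_s^p\Big)(y)\,\vec V_l(y),\end{aligned}$$ where in the first line $(u_k,x_k)$ and $F^\epsilon_{k-1}=F^\epsilon(u_{k-1},x_{k-1})$ are taken at the unperturbed states, and the first of the two derivatives is $0$. Each $B(x_{k-1}^i)$ is the shape derivative at the particle of the gradient of $g_\epsilon=\sum_s\gamma_s(\epsilon)N_s^p\circ\phi_\epsilon^{-1}$: it equals $D_m(\nabla g)-\nabla(\nabla g)\vec V_l$, with the material derivative $D_m(\nabla g)(x)=\frac d{d\epsilon}\nabla g_\epsilon(\phi_\epsilon(x))|_{\epsilon=0^+}$ taken along the particle position moved with the deformation. Finally $D\gamma_s[\vec V_l]=D\gamma(a_s)[\vec V_l]$, where for every regular $x$ $$D\gamma(x)[\vec V_l]=\frac d{d\epsilon}\gamma_\epsilon(x)\Big|_{\epsilon=0^+}=c\,\max\nolimits'_\alpha(d_\Omega(x))\big(-\vec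 V_l(p_{\partial\Omega}(x))\cdot\vec n(p_{\partial\Omega}(x))\big).$$ -/

import Mathlib

open Set Finset

noncomputable section

namespace SPHShape

/-- The plane with its Euclidean norm. -/
abbrev Plane := EuclideanSpace ℝ (Fin 2)

/-- One vector of the plane for each of `N` particles: the Euclidean space of dimension `2 N`. -/
abbrev Config (N : ℕ) := PiLp 2 (fun _ : Fin N => Plane)

/-! ### Conforming triangulations and Lagrange finite elements -/

/-- A finite conforming triangulation. A cell is a nondegenerate triangle, given by its three
vertices; its affine basis coordinates are the barycentric coordinates. -/
structure TriMesh where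
  /-- the triangles -/
  cells : Finset (AffineBasis (Fin 3) ℝ Plane)
  /-- no triangle is listed twice -/
  distinct : ∀ c ∈ cells, ∀ c' ∈ cells, range c = range c' → c = c'
  /-- two triangles meet in the convex hull of their common vertices -/
  conforming : ∀ c ∈ cells, ∀ c' ∈ cells,
    convexHull ℝ (range c) ∩ convexHull ℝ (range c') ⊆ convexHull ℝ (range c ∩ range c')

/-- The closed triangle with the given vertices. -/
def hull (c : AffineBasis (Fin 3) ℝ Plane) : Set Plane := convexHull ℝ (range c)

/-- The multi-indices `β` of length three with `β 0 + β 1 + β 2 = p`; they index the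
`(p + 2)! / (2! p!)` local nodes and shape functions of the Lagrange element of order `p`. -/
def multiIdx (p : ℕ) : Finset (Fin 3 → ℕ) := Finset.Nat.antidiagonalTuple 3 p

/-- The node with barycentric coordinates `β / p` of the Lagrange element of order `p`. -/
def localNode (p : ℕ) (c : AffineBasis (Fin 3) ℝ Plane) (β : Fin 3 → ℕ) : Plane :=
  ∑ i, ((β i : ℝ) / (p : ℝ)) • c i

/-- The Lagrange shape function of order `p` of the node `β`, in barycentric coordinates: the
polynomial of degree `p` that is `1` at the node `β` and `0` at the other nodes. -/
def localShape (p : ℕ) (c : AffineBasis (Fin 3) ℝ Plane) (β : Fin 3 → ℕ) (x : Plane) : ℝ :=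
  ∏ i, ∏ j ∈ Finset.range (β i), ((p : ℝ) * c.coord i x - (j : ℝ)) / ((j : ℝ) + 1)

namespace TriMesh

variable (M : TriMesh)

/-- The vertices of the mesh. -/
def vertices : Set Plane := {v | ∃ c ∈ M.cells, v ∈ range c}

open Classical in
/-- The nodes (degrees of freedom) of the Lagrange elements of order `p`. -/
def nodes (p : ℕ) : Finset Plane :=
  M.cells.biUnion fun c => (multiIdx p).image (localNode p c)

open Classical in
/-- The global Lagrange ansatz function of order `p` of the node `a`, extended by zero outside
the mesh: at a point of a cell it is the shape function of that cell that belongs to `a`, if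
`a` is a node of that cell, and `0` otherwise. -/
def ansatz (p : ℕ) (a x : Plane) : ℝ :=
  if h : ∃ c ∈ M.cells, x ∈ hull c then
    ∑ β ∈ multiIdx p,
      if localNode p h.choose β = a then localShape p h.choose β x else 0
  else 0

end TriMesh

/-! ### Signed distance, projection, normal, smoothed maximum -/

/-- The signed distance function: positive in `Ω`, zero on its boundary, negative outside. -/
def sdist (Ω : Set Plane) (x : Plane) : ℝ :=
  open Classical in
  if x ∈ Ω then Metric.infDist x (frontier Ω) else -Metric.infDist x (frontier Ω)

/-- `q` is a boundary point of `Ω` closest to `x`. -/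
def IsNearest (Ω : Set Plane) (x q : Plane) : Prop :=
  q ∈ frontier Ω ∧ dist x q = Metric.infDist x (frontier Ω)

open Classical in
/-- The projection to the boundary: a closest boundary point (unique for `x` off the ridge). -/
def proj (Ω : Set Plane) (x : Plane) : Plane :=
  if h : ∃ q, IsNearest Ω x q then h.choose else x

/-- `n` is the unit normal to the boundary of `Ω` at `q` that points into `Ω`: every narrow cone
around the line orthogonal to `n` contains the boundary near `q`, with `Ω` on the side of `n` and
the exterior of `Ω` on the other side. There is at most one such `n`. -/
def IsInnerNormal (Ω : Set Plane) (q n : Plane) : Prop :=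
  q ∈ frontier Ω ∧ ‖n‖ = 1 ∧ ∀ η : ℝ, 0 < η → ∀ᶠ y in nhds q,
    (η * ‖y - q‖ < inner ℝ (y - q) n → y ∈ Ω) ∧
    (inner ℝ (y - q) n < -(η * ‖y - q‖) → y ∉ closure Ω)

open Classical in
/-- The unit normal field of the boundary, pointing into `Ω` (from the obstacle to the fluid). -/
def unitNormal (Ω : Set Plane) (q : Plane) : Plane :=
  if h : ∃ n, IsInnerNormal Ω q n then h.choose else 0

/-- The smoothed version of `d ↦ max 0 (1 - d / h)`. -/
def smax (h α d : ℝ) : ℝ :=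
  if -(1 / α) ≤ 1 - d / h ∧ 1 - d / h ≤ 1 / α then
    α / 4 * (1 - d / h) ^ 2 + 1 / 2 * (1 - d / h) + 1 / (4 * α)
  else max 0 (1 - d / h)

/-- The derivative of the smoothed maximum, piece by piece. -/
def smaxDeriv (h α d : ℝ) : ℝ :=
  if 1 - d / h < -(1 / α) then 0
  else if 1 - d / h ≤ 1 / α then -(α / (2 * h)) * (1 - d / h) - 1 / (2 * h)
  else -(1 / h)

/-! ### Material and shape derivatives -/

/-- `G` is the material derivative at `x` of the family `f ε` along the maps `φ ε`: the
derivative at `ε = 0⁺` along the point `φ ε x` that moves with the deformation. -/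
def HasMaterialDeriv {W : Type*} [NormedAddCommGroup W] [NormedSpace ℝ W]
    (φ : ℝ → Plane → Plane) (f : ℝ → Plane → W) (x : Plane) (G : W) : Prop :=
  HasDerivWithinAt (fun ε => f ε (φ ε x)) G (Ici 0) 0

/-- `G` is the shape derivative at `x` of the family `f ε` for the perturbation of identity
`x + ε V(x)`: the material derivative minus the convective term `(∇ f) V`. -/
def HasShapeDeriv {W : Type*} [NormedAddCommGroup W] [NormedSpace ℝ W]
    (V : Plane → Plane) (f : ℝ → Plane → W) (x : Plane) (G : W) : Prop :=
  DifferentiableAt ℝ (f 0) x ∧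
    ∃ Gm, HasMaterialDeriv (fun ε y => y + ε • V y) f x Gm ∧ G = Gm - fderiv ℝ (f 0) x (V x)

/-! ### The particle system -/

/-- The Gaussian kernel in two dimensions. -/
def gaussKernel (h : ℝ) (z : Plane) : ℝ :=
  1 / (Real.pi * h ^ 2) * Real.exp (-(‖z‖ ^ 2 / h ^ 2))

/-- The symplectic Euler iteration
`u (k+1) = u k + (Δt / m) F (u k, x k)`, `x (k+1) = x k + Δt u (k+1)`;
the value at `k` is the pair `(u k, x k)`. -/
def symplecticEuler {N : ℕ} (dt m : ℝ) (F : Config N → Config N → Config N)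
    (u₀ x₀ : Config N) : ℕ → Config N × Config N
  | 0 => (u₀, x₀)
  | k + 1 =>
    let s := symplecticEuler dt m F u₀ x₀ k
    let u := s.1 + (dt / m) • F s.1 s.2
    (u, s.2 + dt • u)

/-- The data of a particle simulation with finite-element boundary forces, together with one
vertex of the mesh and a direction in which it is moved. -/
structure Setup (N : ℕ) where
  /-- the finite-element mesh -/
  mesh : TriMesh
  /-- the polynomial order of the Lagrange elements -/
  p : ℕ
  /-- the fluid domain -/
  Ω : Set Plane
  /-- the perturbed mesh vertex -/
  vtx : Plane
  /-- the direction in which that vertex is moved -/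
  dx : Plane
  /-- the smoothing radius -/
  h : ℝ
  /-- the parameter of the smoothed maximum -/
  α : ℝ
  /-- the constant in front of the smoothed maximum (the reference density, or `1`) -/
  cγ : ℝ
  /-- the nodal coefficients of the outflow layer, which is not subject to the deformation -/
  γL : Plane → ℝ
  /-- the particle mass -/
  m : ℝ
  /-- the time step -/
  dt : ℝ
  /-- the number of time steps -/
  n : ℕ
  /-- the reference density in the relation between density and water height -/
  ρ₀ : ℝ
  /-- the rest height -/
  Hbar : Plane → ℝ
  /-- the discretization points of the shoreline -/
  shore : Finset Plane
  /-- the fluid part of the force (height, viscosity, sediment), a function of the velocities and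
  positions of the particles only -/
  Ffluid : Config N → Config N → Config N
  /-- the initial velocities -/
  u₀ : Config N
  /-- the initial positions -/
  x₀ : Config N

namespace Setup

variable {N : ℕ} (P : Setup N)

/-- The single-vertex perturbation field: the hat function of the vertex times the direction. -/
def V (x : Plane) : Plane := P.mesh.ansatz 1 P.vtx x • P.dx

/-- The discretized perturbation of identity. -/
def φ (ε : ℝ) (x : Plane) : Plane := x + ε • P.V x

/-- The perturbed domain. -/
def dom (ε : ℝ) : Set Plane := P.φ ε '' P.Ω

/-- The ansatz functions of the deformed mesh; they move along with the deformation. -/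
def ansatzE (ε : ℝ) (a y : Plane) : ℝ := P.mesh.ansatz P.p a (Function.invFun (P.φ ε) y)

/-- The smoothed rigid boundary term at the point `x`, for the perturbed domain. -/
def γ (ε : ℝ) (x : Plane) : ℝ := P.cγ * smax P.h P.α (sdist (P.dom ε) x)

/-- The expression `max'_α(d_Ω) (-V·n)`, with `V` and `n` taken at the projection of `x` to the
boundary. -/
def dγ (x : Plane) : ℝ :=
  P.cγ * (smaxDeriv P.h P.α (sdist P.Ω x) *
    (-inner ℝ (P.V (proj P.Ω x)) (unitNormal P.Ω (proj P.Ω x))))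

/-- The finite-element interpolant, on the perturbed domain, of the rigid boundary term. -/
def interp (ε : ℝ) (y : Plane) : ℝ :=
  ∑ a ∈ P.mesh.nodes P.p, P.γ ε a * P.ansatzE ε a y

/-- The boundary density on the perturbed domain: rigid boundaries and outflow layer. -/
def ρD (ε : ℝ) (y : Plane) : ℝ :=
  ∑ a ∈ P.mesh.nodes P.p, P.m * P.γ ε a * P.ansatzE ε a y +
    ∑ a ∈ P.mesh.nodes P.p, P.m * P.γL a * P.ansatzE ε a y

/-- The force on the particles for the perturbed domain: the fluid part and the gradient of the
boundary density. -/
def F (ε : ℝ) (u x : Config N) : Config N :=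
  WithLp.toLp 2 fun i => P.Ffluid u x i + gradient (P.ρD ε) (x i)

/-- The velocities `(traj ε k).1` and positions `(traj ε k).2` of the particles at time step `k`,
for the perturbed domain. -/
def traj (ε : ℝ) : ℕ → Config N × Config N :=
  symplecticEuler P.dt P.m (P.F ε) P.u₀ P.x₀

/-- The velocities for the unperturbed domain. -/
def u (k : ℕ) : Config N := (P.traj 0 k).1

/-- The positions for the unperturbed domain. -/
def x (k : ℕ) : Config N := (P.traj 0 k).2

/-- The contribution of one time step to the wave-height objective, the height being the total
density of all particles over the reference density. -/
def densityCost (ε : ℝ) (_u x : Config N) : ℝ :=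
  ∑ y ∈ P.shore, 1 / 2 * P.dt *
    ((∑ j, P.m * gaussKernel P.h (P.φ ε y - x j)) / P.ρ₀ - P.Hbar (P.φ ε y)) ^ 2

/-- The variant in which the squared deviation is formed for each particle and then summed. -/
def particleCost (ε : ℝ) (_u x : Config N) : ℝ :=
  ∑ y ∈ P.shore, ∑ j, 1 / 2 * P.dt *
    (P.m / P.ρ₀ * gaussKernel P.h (P.φ ε y - x j) - P.Hbar (P.φ ε y)) ^ 2

/-- The discrete objective on the perturbed domain, with the states that belong to that domain;
`J ε u x` is the contribution of one time step. -/
def objective (J : ℝ → Config N → Config N → ℝ) (ε : ℝ) : ℝ :=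
  ∑ k ∈ Finset.Icc 1 P.n, J ε (P.traj ε k).1 (P.traj ε k).2

/-- The adjoint sequences of the particle system on the unperturbed domain, by backward
recursion. -/
structure IsAdjoint (J : ℝ → Config N → Config N → ℝ) (μ δ : ℕ → Config N) : Prop where
  μ_last : μ P.n = gradient (fun w => J 0 w (P.x P.n)) (P.u P.n)
  δ_last : δ P.n = gradient (fun z => J 0 (P.u P.n) z) (P.x P.n)
  μ_step : ∀ k, 1 ≤ k → k < P.n →
    μ k = (μ (k + 1) + P.dt • δ (k + 1)) +
      (P.dt / P.m) • ContinuousLinearMap.adjoint (fderiv ℝ (fun w => P.F 0 w (P.x k)) (P.u k))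
        (μ (k + 1) + P.dt • δ (k + 1)) +
      gradient (fun w => J 0 w (P.x k)) (P.u k)
  δ_step : ∀ k, 1 ≤ k → k < P.n →
    δ k = δ (k + 1) +
      (P.dt / P.m) • ContinuousLinearMap.adjoint (fderiv ℝ (fun z => P.F 0 (P.u k) z) (P.x k))
        (μ (k + 1) + P.dt • δ (k + 1)) +
      gradient (fun z => J 0 (P.u k) z) (P.x k)

/-- Admissible points: wherever `max'_α` does not vanish and the deformation moves a closest
boundary point, that point is the only closest one and the boundary has a normal there. -/
def Regular (x : Plane) : Prop :=
  smaxDeriv P.h P.α (sdist P.Ω x) ≠ 0 → ∀ q, IsNearest P.Ω x q → P.V q ≠ 0 →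
    (∀ q', IsNearest P.Ω x q' → q' = q) ∧ ∃ n, IsInnerNormal P.Ω q n

/-- The bracket
`∇(∑ₛ Dγₛ Nₛ) - (∇V)ᵀ (∑ₛ γₛ ∇Nₛ) - ∇(∑ₛ γₛ ∇Nₛ) V` at the point `y`. -/
def bracket (y : Plane) : Plane :=
  gradient (fun z => ∑ a ∈ P.mesh.nodes P.p, P.dγ a * P.mesh.ansatz P.p a z) y -
    ContinuousLinearMap.adjoint (fderiv ℝ P.V y)
      (∑ a ∈ P.mesh.nodes P.p, P.γ 0 a • gradient (P.mesh.ansatz P.p a) y) -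
    fderiv ℝ (fun z => ∑ a ∈ P.mesh.nodes P.p, P.γ 0 a • gradient (P.mesh.ansatz P.p a) z) y
      (P.V y)

/-- The claimed value of the shape derivative: the sum over time steps and particles. -/
def shapeSum (μ δ : ℕ → Config N) : ℝ :=
  ∑ k ∈ Finset.Icc 1 P.n, ∑ i,
    inner ℝ (P.bracket (P.x (k - 1) i)) (P.dt • μ k i + P.dt ^ 2 • δ k i)

end Setup

end SPHShape

end

namespace SPHShape

open Filter Topology

/-! ### Continuous functions that are Lipschitz on the pieces of a finite closed cover -/

theorem lipschitzWith_of_finite_closed_cover {E ι : Type*} [NormedAddCommGroup E]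
    [NormedSpace ℝ E] [Finite ι] {A : ι → Set E} (hA : ∀ i, IsClosed (A i))
    (hcover : ∀ x, ∃ i, x ∈ A i) {f : E → ℝ} (hf : Continuous f) {K : NNReal}
    (hK : ∀ i, LipschitzOnWith K f (A i)) : LipschitzWith K f := by
  refine LipschitzWith.of_le_add_mul K fun y x => ?_
  set l : ℝ → E := fun t => AffineMap.lineMap x y t with hl
  have hlc : Continuous l := AffineMap.lineMap_continuous
  have hdist : ∀ s t, dist (l s) (l t) = dist s t * dist x y := fun s t =>
    dist_lineMap_lineMap x y s t
  have key := image_le_of_liminf_slope_right_le_deriv_boundary (f := fun t => f (l t))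
    (a := 0) (b := 1) (hf.comp hlc).continuousOn (B := fun t => f x + K * dist x y * t)
    (B' := fun _ => K * dist x y) (by simp [hl]) (by fun_prop)
    (fun t _ => by
      simpa using ((hasDerivWithinAt_id t (Ici t)).const_mul (K * dist x y)).const_add (f x))
    (fun t _ r hr => by
      have hex : ∃ᶠ z in 𝓝[>] t, ∃ i, l z ∈ A i :=
        (Eventually.of_forall fun z => hcover (l z)).frequently
      obtain ⟨i, hi⟩ : ∃ i, ∃ᶠ z in 𝓝[>] t, l z ∈ A i := by
        by_contra! hcon
        refine hex ?_
        filter_upwards [eventually_all.2 hcon] with z hz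
        simpa using hz
      have hti : l t ∈ A i := by
        have hmem : t ∈ closure (l ⁻¹' A i) := by
          rw [mem_closure_iff_frequently]
          exact hi.filter_mono nhdsWithin_le_nhds
        rwa [((hA i).preimage hlc).closure_eq] at hmem
      refine (hi.and_eventually self_mem_nhdsWithin).mono fun z hz => ?_
      obtain ⟨hz, htz⟩ := hz
      have htz : t < z := htz
      have h1 := (hK i).dist_le_mul _ hz _ hti
      rw [hdist, Real.dist_eq, Real.dist_eq, abs_of_pos (sub_pos.2 htz)] at h1
      rw [slope_def_field, div_lt_iff₀ (sub_pos.2 htz)]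
      calc f (l z) - f (l t) ≤ K * ((z - t) * dist x y) := (le_abs_self _).trans h1
        _ = K * dist x y * (z - t) := by ring
        _ < r * (z - t) := mul_lt_mul_of_pos_right hr (sub_pos.2 htz))
  have := key (right_mem_Icc.2 zero_le_one)
  simpa [hl, dist_comm] using this

/-! ### The cells of a triangulation -/

theorem isClosed_hull (c : AffineBasis (Fin 3) ℝ Plane) : IsClosed (hull c) :=
  (Set.finite_range c).isClosed_convexHull ℝ

theorem mem_hull_iff {c : AffineBasis (Fin 3) ℝ Plane} {x : Plane} :
    x ∈ hull c ↔ ∀ i, 0 ≤ c.coord i x := by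
  rw [hull, c.convexHull_eq_nonneg_coord]; rfl

theorem mem_interior_hull_iff {c : AffineBasis (Fin 3) ℝ Plane} {x : Plane} :
    x ∈ interior (hull c) ↔ ∀ i, 0 < c.coord i x := by
  rw [hull, c.interior_convexHull]; rfl

theorem closure_interior_hull (c : AffineBasis (Fin 3) ℝ Plane) :
    closure (interior (hull c)) = hull c := by
  rw [hull, (convex_convexHull ℝ _).closure_interior_eq_closure_of_nonempty_interior
    ⟨_, c.centroid_mem_interior_convexHull⟩]
  exact (isClosed_hull c).closure_eq

theorem TriMesh.eq_of_mem_interior (M : TriMesh) {c c' : AffineBasis (Fin 3) ℝ Plane}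
    (hc : c ∈ M.cells) (hc' : c' ∈ M.cells) {x : Plane} (hx : x ∈ interior (hull c))
    (hx' : x ∈ hull c') : c = c' := by
  have hmem := M.conforming c hc c' hc' ⟨interior_subset hx, hx'⟩
  rw [mem_interior_hull_iff] at hx
  have hsub : Set.range c ⊆ Set.range c' := by
    rintro _ ⟨i, rfl⟩
    by_contra hi
    have h0 : convexHull ℝ (Set.range c ∩ Set.range c') ⊆ (c.coord i) ⁻¹' {0} := by
      refine convexHull_min ?_ ((convex_singleton (0 : ℝ)).affine_preimage (c.coord i))
      rintro _ ⟨⟨j, rfl⟩, hj⟩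
      have hij : i ≠ j := fun h => hi (h ▸ hj)
      simp [c.coord_apply_ne hij]
    exact (hx i).ne' (h0 hmem)
  refine M.distinct c hc c' hc' (Set.eq_of_subset_of_ncard_le hsub ?_ (Set.finite_range c'))
  rw [← Set.image_univ, ← Set.image_univ, Set.ncard_image_of_injective _ c.ind.injective,
    Set.ncard_image_of_injective _ c'.ind.injective]

open Classical in
/-- The function that coincides on the cell `c` with the ansatz function of the node `a`. -/
noncomputable def cellAnsatz (p : ℕ) (c : AffineBasis (Fin 3) ℝ Plane) (a x : Plane) : ℝ :=
  ∑ β ∈ multiIdx p, if localNode p c β = a then localShape p c β x else 0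

theorem TriMesh.ansatz_of_mem_interior (M : TriMesh) (p : ℕ)
    {c : AffineBasis (Fin 3) ℝ Plane} (hc : c ∈ M.cells) (a : Plane) {x : Plane}
    (hx : x ∈ interior (hull c)) : M.ansatz p a x = cellAnsatz p c a x := by
  have h : ∃ c ∈ M.cells, x ∈ hull c := ⟨c, hc, interior_subset hx⟩
  have hch : h.choose = c :=
    (M.eq_of_mem_interior hc h.choose_spec.1 hx h.choose_spec.2).symm
  rw [TriMesh.ansatz, dif_pos h, hch, cellAnsatz]

theorem TriMesh.ansatz_of_notMem (M : TriMesh) (p : ℕ) (a : Plane) {x : Plane}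
    (hx : ∀ c ∈ M.cells, x ∉ hull c) : M.ansatz p a x = 0 := by
  rw [TriMesh.ansatz, dif_neg]
  rintro ⟨c, hc, h⟩
  exact hx c hc h

/-- A barycentric coordinate is an affine functional. -/
theorem exists_coord_eq (c : AffineBasis (Fin 3) ℝ Plane) (i : Fin 3) :
    ∃ (e : Plane) (k : ℝ), ∀ x, c.coord i x = inner ℝ e x + k := by
  refine ⟨(InnerProductSpace.toDual ℝ Plane).symm
    (LinearMap.toContinuousLinearMap (c.coord i).linear), c.coord i 0, fun x => ?_⟩
  rw [InnerProductSpace.toDual_symm_apply]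
  exact congrFun (c.coord i).decomp x

theorem contDiff_coord (c : AffineBasis (Fin 3) ℝ Plane) (i : Fin 3) {n : WithTop ℕ∞} :
    ContDiff ℝ n (c.coord i) := by
  obtain ⟨e, k, h⟩ := exists_coord_eq c i
  rw [show ⇑(c.coord i) = fun x => inner ℝ e x + k from funext h]
  exact (contDiff_const.inner ℝ contDiff_id).add contDiff_const

theorem contDiff_cellAnsatz (p : ℕ) (c : AffineBasis (Fin 3) ℝ Plane) (a : Plane)
    {n : WithTop ℕ∞} : ContDiff ℝ n (cellAnsatz p c a) := by
  classical
  refine ContDiff.sum fun β _ => ?_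
  split_ifs
  · refine contDiff_prod fun i _ => contDiff_prod fun j _ => ?_
    have := contDiff_coord c i (n := n)
    fun_prop
  · exact contDiff_const

theorem multiIdx_one :
    multiIdx 1 = {![1, 0, 0], ![0, 1, 0], ![0, 0, 1]} := by
  decide

open Classical in
theorem cellAnsatz_one (c : AffineBasis (Fin 3) ℝ Plane) (a x : Plane) :
    cellAnsatz 1 c a x = ∑ i, if c i = a then c.coord i x else 0 := by
  rw [cellAnsatz, multiIdx_one, Finset.sum_insert (by decide), Finset.sum_insert (by decide),
    Finset.sum_singleton, Fin.sum_univ_three]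
  simp [localNode, localShape, Fin.sum_univ_three, Fin.prod_univ_three, add_assoc]

theorem cellAnsatz_one_of_eq {c : AffineBasis (Fin 3) ℝ Plane} {a : Plane} {i : Fin 3}
    (hi : c i = a) (x : Plane) : cellAnsatz 1 c a x = c.coord i x := by
  classical
  rw [cellAnsatz_one, Finset.sum_eq_single i]
  · simp [hi]
  · intro j _ hj
    rw [if_neg]
    intro h
    exact hj (c.ind.injective (h.trans hi.symm))
  · simp

theorem cellAnsatz_one_of_notMem {c : AffineBasis (Fin 3) ℝ Plane} {a : Plane}
    (ha : a ∉ Set.range c) (x : Plane) : cellAnsatz 1 c a x = 0 := by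
  classical
  rw [cellAnsatz_one]
  exact Finset.sum_eq_zero fun i _ => if_neg fun h => ha ⟨i, h⟩

theorem exists_cellAnsatz_one_eq (c : AffineBasis (Fin 3) ℝ Plane) (a : Plane) :
    ∃ (e : Plane) (k : ℝ), ∀ x, cellAnsatz 1 c a x = inner ℝ e x + k := by
  by_cases ha : a ∈ Set.range c
  · obtain ⟨i, hi⟩ := ha
    obtain ⟨e, k, h⟩ := exists_coord_eq c i
    exact ⟨e, k, fun x => (cellAnsatz_one_of_eq hi x).trans (h x)⟩
  · exact ⟨0, 0, fun x => by simp [cellAnsatz_one_of_notMem ha]⟩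

/-- A continuous ansatz function is given on the closed cells by the formulas of the cells. -/
theorem TriMesh.ansatz_of_mem_hull (M : TriMesh) {p : ℕ} {a : Plane}
    (hcont : Continuous (M.ansatz p a)) {c : AffineBasis (Fin 3) ℝ Plane} (hc : c ∈ M.cells)
    {x : Plane} (hx : x ∈ hull c) : M.ansatz p a x = cellAnsatz p c a x := by
  have h : EqOn (M.ansatz p a) (cellAnsatz p c a) (interior (hull c)) := fun y hy =>
    M.ansatz_of_mem_interior p hc a hy
  refine h.closure hcont (contDiff_cellAnsatz p c a (n := 0)).continuous ?_
  rwa [closure_interior_hull]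

theorem TriMesh.hat_mem_Icc (M : TriMesh) {a : Plane} (hcont : Continuous (M.ansatz 1 a))
    (x : Plane) : M.ansatz 1 a x ∈ Set.Icc (0 : ℝ) 1 := by
  by_cases h : ∃ c ∈ M.cells, x ∈ hull c
  · obtain ⟨c, hc, hx⟩ := h
    rw [M.ansatz_of_mem_hull hcont hc hx]
    rw [mem_hull_iff] at hx
    by_cases ha : a ∈ Set.range c
    · obtain ⟨i, hi⟩ := ha
      rw [cellAnsatz_one_of_eq hi]
      refine ⟨hx i, ?_⟩
      rw [← c.sum_coord_apply_eq_one x]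
      exact Finset.single_le_sum (f := fun j => c.coord j x) (fun j _ => hx j)
        (Finset.mem_univ i)
    · simp [cellAnsatz_one_of_notMem ha]
  · rw [M.ansatz_of_notMem 1 a (by simpa using h)]
    simp

theorem TriMesh.exists_lipschitzWith_hat (M : TriMesh) {a : Plane}
    (hcont : Continuous (M.ansatz 1 a)) : ∃ K, LipschitzWith K (M.ansatz 1 a) := by
  choose e k he using fun c : AffineBasis (Fin 3) ℝ Plane => exists_cellAnsatz_one_eq c a
  let U : Set Plane := {x | ∀ c ∈ M.cells, x ∉ hull c}
  refine ⟨∑ c ∈ M.cells, ‖e c‖₊, lipschitzWith_of_finite_closed_cover (ι := Option M.cells)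
    (A := fun o => o.elim (closure U) fun c => hull c.1) ?_ ?_ hcont ?_⟩
  · rintro (_ | c)
    · exact isClosed_closure
    · exact isClosed_hull _
  · intro x
    by_cases h : ∃ c ∈ M.cells, x ∈ hull c
    · obtain ⟨c, hc, hx⟩ := h
      exact ⟨some ⟨c, hc⟩, hx⟩
    · exact ⟨none, subset_closure (by simpa [U] using h)⟩
  · rintro (_ | ⟨c, hc⟩)
    · have h0 : EqOn (M.ansatz 1 a) (fun _ => 0) (closure U) :=
        EqOn.closure (fun x hx => M.ansatz_of_notMem 1 a hx) hcont continuous_const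
      intro x hx y hy
      rw [h0 hx, h0 hy]
      simp
    · refine LipschitzOnWith.of_dist_le_mul fun x hx y hy => ?_
      rw [M.ansatz_of_mem_hull hcont hc hx, M.ansatz_of_mem_hull hcont hc hy, he, he,
        Real.dist_eq, dist_eq_norm, add_sub_add_right_eq_sub, ← inner_sub_right]
      refine (abs_real_inner_le_norm _ _).trans (mul_le_mul_of_nonneg_right ?_ (norm_nonneg _))
      have := Finset.single_le_sum (f := fun c => ‖e c‖₊) (fun _ _ => zero_le) hc
      exact_mod_cast this

/-! ### Perturbations of the identity -/

theorem isHomeomorph_perturbation {V : Plane → Plane} {K : NNReal} (hV : LipschitzWith K V)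
    {ε : ℝ} (hε : |ε| * K < 1) : IsHomeomorph fun x => x + ε • V x := by
  set f : Plane → Plane := fun x => x + ε • V x
  have happ : ApproximatesLinearOn f
      ((ContinuousLinearEquiv.refl ℝ Plane : Plane ≃L[ℝ] Plane) : Plane →L[ℝ] Plane)
      Set.univ (‖ε‖₊ * K) := by
    intro x _ y _
    have h : f x - f y - (x - y) = ε • (V x - V y) := by
      simp only [f, smul_sub]
      abel
    rw [ContinuousLinearEquiv.coe_coe, ContinuousLinearEquiv.refl_apply, h, norm_smul,
      ← dist_eq_norm, ← dist_eq_norm]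
    push_cast
    rw [mul_assoc]
    exact mul_le_mul_of_nonneg_left (hV.dist_le_mul x y) (norm_nonneg ε)
  have hN : ‖((ContinuousLinearEquiv.refl ℝ Plane).symm : Plane →L[ℝ] Plane)‖₊ = 1 := by
    rw [ContinuousLinearEquiv.refl_symm, ContinuousLinearEquiv.coe_refl]
    exact nnnorm_one
  have hc : ‖ε‖₊ * K < 1 := by
    rw [← NNReal.coe_lt_coe]
    simpa using hε
  exact (happ.toHomeomorph f (Or.inr (by rw [hN, inv_one]; exact hc))).isHomeomorph

theorem hasDerivWithinAt_Ici_zero_of_eventually_abs_le {f : ℝ → ℝ} {l : ℝ}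
    (h : ∀ κ > 0, ∀ᶠ ε in 𝓝[>] (0 : ℝ), |f ε - f 0 - ε * l| ≤ κ * ε) :
    HasDerivWithinAt f l (Set.Ici 0) 0 := by
  rw [← hasDerivWithinAt_Ioi_iff_Ici, hasDerivWithinAt_iff_isLittleO, Asymptotics.isLittleO_iff]
  intro κ hκ
  filter_upwards [h κ hκ, self_mem_nhdsWithin] with ε h1 h2
  have h2 : 0 < ε := h2
  simpa [abs_of_pos h2] using h1

theorem exists_mem_frontier_of_segment {E : Type*} [NormedAddCommGroup E] [NormedSpace ℝ E]
    {s : Set E} {x y : E} (hx : x ∈ s) (hy : y ∉ s) : ∃ z ∈ segment ℝ x y, z ∈ frontier s := by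
  by_contra! hcon
  have hpre : IsPreconnected (segment ℝ x y) := (convex_segment x y).isPreconnected
  have hsub : segment ℝ x y ⊆ interior s ∪ (closure s)ᶜ := by
    intro z hz
    by_contra h
    rw [Set.mem_union, not_or, Set.mem_compl_iff, not_not] at h
    exact hcon z hz ⟨h.2, h.1⟩
  have h1 : x ∈ interior s := by
    refine (hsub (left_mem_segment ℝ x y)).resolve_right fun h => h (subset_closure hx)
  have h2 : y ∈ (closure s)ᶜ := by
    refine (hsub (right_mem_segment ℝ x y)).resolve_left fun h => hy (interior_subset h)
  obtain ⟨z, -, hz1, hz2⟩ := hpre _ _ isOpen_interior isClosed_closure.isOpen_compl hsub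
    ⟨x, left_mem_segment ℝ x y, h1⟩ ⟨y, right_mem_segment ℝ x y, h2⟩
  exact hz2 (subset_closure (interior_subset hz1))

theorem infDist_frontier_le_of_notMem {E : Type*} [NormedAddCommGroup E] [NormedSpace ℝ E]
    {s : Set E} {x y : E} (h : ¬(x ∈ s ↔ y ∈ s)) : Metric.infDist x (frontier s) ≤ dist x y := by
  obtain ⟨z, hz, hzs⟩ : ∃ z ∈ segment ℝ x y, z ∈ frontier s := by
    by_cases hx : x ∈ s
    · exact exists_mem_frontier_of_segment hx fun hy => h (iff_of_true hx hy)
    · have hy : y ∈ s := by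
        by_contra hy
        exact h (iff_of_false hx hy)
      rw [segment_symm]
      exact exists_mem_frontier_of_segment hy hx
  refine (Metric.infDist_le_dist_of_mem hzs).trans ?_
  rw [dist_comm, dist_eq_norm, dist_eq_norm, ← norm_neg (x - y), neg_sub]
  exact norm_sub_le_of_mem_segment hz

section Perturbed

variable {V : Plane → Plane} {K : NNReal} {C : ℝ} {Ω : Set Plane}

theorem frontier_perturbation (hV : LipschitzWith K V) {ε : ℝ} (hε : |ε| * K < 1) :
    frontier ((fun x => x + ε • V x) '' Ω) = (fun x => x + ε • V x) '' frontier Ω :=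
  ((isHomeomorph_perturbation hV hε).image_frontier Ω).symm

theorem abs_infDist_perturbation_sub_le {Γ : Set Plane} (hC : ∀ x, ‖V x‖ ≤ C) (y : Plane) {ε : ℝ}
    (hε : 0 ≤ ε) :
    |Metric.infDist y ((fun x => x + ε • V x) '' Γ) - Metric.infDist y Γ| ≤ ε * C := by
  have hC0 : 0 ≤ C := (norm_nonneg _).trans (hC 0)
  rcases Γ.eq_empty_or_nonempty with rfl | hne
  · simpa using mul_nonneg hε hC0
  have hd : ∀ x, dist x (x + ε • V x) ≤ ε * C := fun x => by
    rw [dist_self_add_right, norm_smul, Real.norm_of_nonneg hε]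
    exact mul_le_mul_of_nonneg_left (hC x) hε
  rw [abs_le]
  constructor
  · rw [neg_le_sub_iff_le_add', ← sub_le_iff_le_add']
    refine (Metric.le_infDist (hne.image _)).2 ?_
    rintro _ ⟨x, hx, rfl⟩
    have h1 := Metric.infDist_le_dist_of_mem (x := y) hx
    have h2 := dist_triangle_right y x (x + ε • V x)
    have h3 := hd x
    simp only
    linarith
  · rw [sub_le_iff_le_add, ← sub_le_iff_le_add']
    refine (Metric.le_infDist hne).2 fun x hx => ?_
    have h1 := Metric.infDist_le_dist_of_mem (x := y)
      (Set.mem_image_of_mem (fun x => x + ε • V x) hx)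
    have h2 := dist_triangle y x (x + ε • V x)
    have h3 := hd x
    linarith

theorem exists_preimage_perturbation (hV : LipschitzWith K V) (hC : ∀ x, ‖V x‖ ≤ C) {ε : ℝ}
    (h0 : 0 ≤ ε) (hε : |ε| * K < 1) (y : Plane) : ∃ z, z + ε • V z = y ∧ dist y z ≤ ε * C ∧
      (y ∈ (fun x => x + ε • V x) '' Ω ↔ z ∈ Ω) := by
  have hh := isHomeomorph_perturbation hV hε
  obtain ⟨z, rfl⟩ := hh.bijective.2 y
  refine ⟨z, rfl, ?_, hh.bijective.1.mem_set_image⟩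
  simp only
  rw [dist_self_add_left, norm_smul, Real.norm_of_nonneg h0]
  exact mul_le_mul_of_nonneg_left (hC z) h0

theorem abs_sdist_perturbation_sub_le (hV : LipschitzWith K V) (hC : ∀ x, ‖V x‖ ≤ C) (y : Plane)
    {ε : ℝ} (h0 : 0 ≤ ε) (hε : |ε| * K < 1) :
    |sdist ((fun x => x + ε • V x) '' Ω) y - sdist Ω y| ≤ 3 * (ε * C) := by
  obtain ⟨z, -, hz, hiff⟩ := exists_preimage_perturbation (Ω := Ω) hV hC h0 hε y
  have hd := abs_infDist_perturbation_sub_le (Γ := frontier Ω) hC y h0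
  have hn : 0 ≤ ε * C := dist_nonneg.trans hz
  unfold sdist
  rw [frontier_perturbation hV hε]
  have hp1 := Metric.infDist_nonneg (x := y) (s := frontier Ω)
  have hp2 := Metric.infDist_nonneg (x := y) (s := (fun x => x + ε • V x) '' frontier Ω)
  rw [abs_le] at hd ⊢
  by_cases hy : y ∈ Ω <;> by_cases hzΩ : z ∈ Ω
  · rw [if_pos (hiff.2 hzΩ), if_pos hy]
    constructor <;> linarith
  · have := infDist_frontier_le_of_notMem (s := Ω) (x := y) (y := z) (by tauto)
    rw [if_neg (by tauto), if_pos hy]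
    constructor <;> linarith
  · have := infDist_frontier_le_of_notMem (s := Ω) (x := y) (y := z) (by tauto)
    rw [if_pos (hiff.2 hzΩ), if_neg hy]
    constructor <;> linarith
  · rw [if_neg (by tauto), if_neg hy]
    constructor <;> linarith

theorem eventually_abs_mul_lt_one (K : NNReal) : ∀ᶠ ε : ℝ in 𝓝 0, |ε| * K < 1 := by
  have h : Tendsto (fun ε : ℝ => |ε| * K) (𝓝 0) (𝓝 0) := by
    have : Continuous fun ε : ℝ => |ε| * (K : ℝ) := by fun_prop
    simpa using this.tendsto 0
  exact h.eventually (gt_mem_nhds one_pos)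

/-! ### The distance to the perturbed boundary at points off the boundary -/

theorem exists_radius_lt_of_nearest {Γ : Set Plane} (hΓ : IsClosed Γ) {y : Plane} {L : Plane → ℝ}
    (hL : ContinuousOn L Γ) {l : ℝ}
    (hnear : ∀ q ∈ Γ, dist y q = Metric.infDist y Γ → L q = l) {η : ℝ} (hη : 0 < η) :
    ∃ r > 0, ∀ w ∈ Γ, dist y w < Metric.infDist y Γ + r → l - η < L w := by
  set d := Metric.infDist y Γ
  set A : Set Plane := (Γ ∩ L ⁻¹' Set.Iic (l - η)) ∩ Metric.closedBall y (d + 1)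
  have hAc : IsCompact A :=
    (isCompact_closedBall y (d + 1)).inter_left (hL.preimage_isClosed_of_isClosed hΓ isClosed_Iic)
  rcases A.eq_empty_or_nonempty with hA | hA
  · refine ⟨1, one_pos, fun w hw hd => ?_⟩
    by_contra! hcon
    have : w ∈ A := ⟨⟨hw, hcon⟩, by rw [Metric.mem_closedBall, dist_comm]; exact hd.le⟩
    simp [hA] at this
  · obtain ⟨w₀, hw₀, hmin⟩ := hAc.exists_isMinOn hA
      (f := fun w => dist y w) (by fun_prop)
    have hle : d ≤ dist y w₀ := Metric.infDist_le_dist_of_mem hw₀.1.1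
    have hne : dist y w₀ ≠ d := fun h => by
      have h1 := hnear w₀ hw₀.1.1 h
      have h2 : L w₀ ≤ l - η := hw₀.1.2
      linarith
    have hlt : d < dist y w₀ := lt_of_le_of_ne hle hne.symm
    refine ⟨min 1 (dist y w₀ - d), lt_min one_pos (by linarith), fun w hw hd => ?_⟩
    by_contra! hcon
    have h1 : d + min 1 (dist y w₀ - d) ≤ d + 1 := by gcongr; exact min_le_left _ _
    have h2 : d + min 1 (dist y w₀ - d) ≤ dist y w₀ := by
      have := min_le_right 1 (dist y w₀ - d)
      linarith
    have hwA : w ∈ A := ⟨⟨hw, hcon⟩, by rw [Metric.mem_closedBall, dist_comm]; linarith⟩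
    have := hmin hwA
    simp only [Set.mem_ofPred_eq] at this
    linarith

theorem hasDerivAt_norm_add_smul {u v : Plane} (hu : u ≠ 0) :
    HasDerivAt (fun ε : ℝ => ‖u + ε • v‖) (inner ℝ v u / ‖u‖) 0 := by
  have h1 : HasDerivAt (fun ε : ℝ => u + ε • v) v 0 := by
    simpa using ((hasDerivAt_id (0 : ℝ)).smul_const v).const_add u
  have h2 := h1.norm_sq.sqrt (by simpa using hu)
  simp only [Real.sqrt_sq (norm_nonneg _)] at h2
  convert h2 using 1
  simp only [zero_smul, add_zero, real_inner_comm]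
  field_simp

/-- Danskin's theorem for the distance to a perturbed closed set, when all closest points have the
same normal velocity. -/
theorem hasDerivWithinAt_infDist_perturbation {Γ : Set Plane} (hΓ : IsClosed Γ)
    (hne : Γ.Nonempty) (hVc : Continuous V) (hC : ∀ x, ‖V x‖ ≤ C) {y : Plane} (hy : y ∉ Γ) {l : ℝ}
    (hnear : ∀ q ∈ Γ, dist y q = Metric.infDist y Γ → inner ℝ (V q) (q - y) / ‖q - y‖ = l) :
    HasDerivWithinAt (fun ε : ℝ => Metric.infDist y ((fun x => x + ε • V x) '' Γ)) l
      (Set.Ici 0) 0 := by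
  set d := Metric.infDist y Γ with hd
  refine hasDerivWithinAt_Ici_zero_of_eventually_abs_le fun κ hκ => ?_
  have himg : (fun x : Plane => x + (0 : ℝ) • V x) '' Γ = Γ := by simp
  obtain ⟨q, hq, hqd⟩ := hΓ.exists_infDist_eq_dist hne y
  have hsub : ∀ w ∈ Γ, w - y ≠ 0 := fun w hw h => hy (sub_eq_zero.1 h ▸ hw)
  have hup : ∀ᶠ ε in 𝓝[>] (0 : ℝ), |‖(q - y) + ε • V q‖ - ‖q - y‖ - ε * l| ≤ κ * ε := by
    have h1 := hasDerivAt_norm_add_smul (v := V q) (hsub q hq)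
    rw [hnear q hq hqd.symm, hasDerivAt_iff_isLittleO, Asymptotics.isLittleO_iff] at h1
    filter_upwards [nhdsWithin_le_nhds (h1 hκ), self_mem_nhdsWithin] with ε h2 h3
    have h3 : 0 < ε := h3
    simpa [abs_of_pos h3] using h2
  have hLc : ContinuousOn (fun w => inner ℝ (V w) (w - y) / ‖w - y‖) Γ := by
    refine ContinuousOn.div ?_ (by fun_prop) fun w hw => norm_ne_zero_iff.2 (hsub w hw)
    exact (hVc.inner (continuous_id.sub continuous_const)).continuousOn
  obtain ⟨r, hr, hrad⟩ := exists_radius_lt_of_nearest hΓ hLc hnear hκ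
  have hsmall : ∀ᶠ ε in 𝓝[>] (0 : ℝ), ε * (C + |l - κ|) < r := by
    have h : Tendsto (fun ε : ℝ => ε * (C + |l - κ|)) (𝓝 0) (𝓝 0) := by
      have : Continuous fun ε : ℝ => ε * (C + |l - κ|) := by fun_prop
      simpa using this.tendsto 0
    exact nhdsWithin_le_nhds (h.eventually (gt_mem_nhds hr))
  filter_upwards [hup, hsmall, self_mem_nhdsWithin] with ε h1 h2 h3
  have h3 : 0 < ε := h3
  have hdq : d = ‖q - y‖ := by rw [hd, hqd, dist_comm, dist_eq_norm]
  simp only [himg]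
  rw [abs_le]
  constructor
  · suffices d + ε * (l - κ) ≤ Metric.infDist y ((fun x => x + ε • V x) '' Γ) by linarith
    refine (Metric.le_infDist (hne.image _)).2 ?_
    rintro _ ⟨w, hw, rfl⟩
    have hwd : d ≤ dist y w := Metric.infDist_le_dist_of_mem hw
    rw [dist_comm, dist_eq_norm] at hwd ⊢
    have hpos : 0 < ‖w - y‖ := norm_pos_iff.2 (hsub w hw)
    rw [show w + ε • V w - y = (w - y) + ε • V w by abel]
    by_cases hwr : dist y w < d + r
    · have hl := hrad w hw hwr
      have h4 : inner ℝ ((w - y) + ε • V w) (w - y) ≤ ‖(w - y) + ε • V w‖ * ‖w - y‖ :=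
        real_inner_le_norm _ _
      rw [inner_add_left, real_inner_self_eq_norm_sq, real_inner_smul_left] at h4
      have h5 : ‖w - y‖ + ε * (inner ℝ (V w) (w - y) / ‖w - y‖) ≤ ‖(w - y) + ε • V w‖ := by
        rw [← mul_le_mul_iff_left₀ hpos]
        calc _ = ‖w - y‖ ^ 2 + ε * inner ℝ (V w) (w - y) := by field_simp
          _ ≤ _ := h4
      have h6 := mul_lt_mul_of_pos_left hl h3
      linarith
    · rw [not_lt, dist_comm, dist_eq_norm] at hwr
      have h4 : ‖w - y‖ ≤ ‖(w - y) + ε • V w‖ + ‖ε • V w‖ := by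
        simpa using norm_sub_le ((w - y) + ε • V w) (ε • V w)
      rw [norm_smul, Real.norm_of_nonneg h3.le] at h4
      have h5 := mul_le_mul_of_nonneg_left (hC w) h3.le
      have h6 := mul_le_mul_of_nonneg_left (le_abs_self (l - κ)) h3.le
      rw [mul_add] at h2
      linarith
  · have h4 := Metric.infDist_le_dist_of_mem (x := y)
      (Set.mem_image_of_mem (fun x => x + ε • V x) hq)
    rw [dist_comm, dist_eq_norm, show q + ε • V q - y = (q - y) + ε • V q by abel] at h4
    have h5 := (abs_le.1 h1).2
    linarith

end Perturbed

section Perturbed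

variable {V : Plane → Plane} {K : NNReal} {C : ℝ} {Ω : Set Plane}

theorem eq_of_forall_inner_pos {m n : Plane} (hm : ‖m‖ = 1) (hn : ‖n‖ = 1)
    (h : ∀ w : Plane, 0 < inner ℝ w m → 0 ≤ inner ℝ w n) : m = n := by
  have hmm : inner ℝ m m = (1 : ℝ) := by rw [real_inner_self_eq_norm_sq, hm, one_pow]
  have hnn : inner ℝ n n = (1 : ℝ) := by rw [real_inner_self_eq_norm_sq, hn, one_pow]
  set c : ℝ := inner ℝ m n with hc
  have hc0 : 0 ≤ c := h m (by rw [hmm]; exact one_pos)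
  have key : ∀ t : ℝ, 0 < t → 0 ≤ t * c - (1 - c ^ 2) := fun t ht => by
    have h1 := h (t • m - (n - c • m)) (by
      rw [inner_sub_left, inner_sub_left, inner_smul_left, inner_smul_left, hmm,
        real_inner_comm, ← hc]
      simpa using ht)
    rw [inner_sub_left, inner_sub_left, inner_smul_left, inner_smul_left, hnn, ← hc] at h1
    simp only [conj_trivial] at h1
    linarith
  have hc1 : 1 ≤ c := by
    by_contra! hlt
    have h0 : 0 < 1 - c ^ 2 := by nlinarith
    have h1 := key ((1 - c ^ 2) / 2) (by linarith)
    nlinarith [mul_pos h0 (show 0 < 1 - c / 2 by linarith)]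
  have hc2 : c ≤ 1 := by
    have := real_inner_le_norm m n
    rw [hm, hn] at this
    linarith
  exact (inner_eq_one_iff_of_norm_eq_one hm hn).1 (le_antisymm hc2 hc1)

/-- A direction that stays in the closure of `Ω` makes no obtuse angle with the inner normal. -/
theorem IsInnerNormal.inner_nonneg {q n w : Plane} (hn : IsInnerNormal Ω q n)
    (hw : ∀ᶠ t in 𝓝[>] (0 : ℝ), q + t • w ∈ closure Ω) : 0 ≤ (inner ℝ w n : ℝ) := by
  by_contra! hneg
  have hw0 : 0 < ‖w‖ := norm_pos_iff.2 fun h => by simp [h] at hneg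
  have hη : 0 < -(inner ℝ w n : ℝ) / (2 * ‖w‖) := by
    have : 0 < -(inner ℝ w n : ℝ) := by linarith
    positivity
  have htend : Tendsto (fun t : ℝ => q + t • w) (𝓝[>] 0) (𝓝 q) := by
    have : Continuous fun t : ℝ => q + t • w := by fun_prop
    simpa using (this.tendsto 0).mono_left nhdsWithin_le_nhds
  obtain ⟨t, ht1, ht2, ht3⟩ :=
    (hw.and ((htend.eventually (hn.2.2 _ hη)).and self_mem_nhdsWithin)).exists
  have ht3 : 0 < t := ht3
  refine ht2.2 ?_ ht1
  rw [add_sub_cancel_left, inner_smul_left, norm_smul, Real.norm_of_nonneg ht3.le]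
  simp only [conj_trivial]
  have : -(inner ℝ w n : ℝ) / (2 * ‖w‖) * (t * ‖w‖) = t * (-(inner ℝ w n : ℝ) / 2) := by
    field_simp
  rw [this]
  nlinarith

/-- A direction that avoids `Ω` makes no acute angle with the inner normal. -/
theorem IsInnerNormal.inner_nonpos {q n w : Plane} (hn : IsInnerNormal Ω q n)
    (hw : ∀ᶠ t in 𝓝[>] (0 : ℝ), q + t • w ∉ Ω) : (inner ℝ w n : ℝ) ≤ 0 := by
  by_contra! hpos
  have hw0 : 0 < ‖w‖ := norm_pos_iff.2 fun h => by simp [h] at hpos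
  have hη : 0 < (inner ℝ w n : ℝ) / (2 * ‖w‖) := by positivity
  have htend : Tendsto (fun t : ℝ => q + t • w) (𝓝[>] 0) (𝓝 q) := by
    have : Continuous fun t : ℝ => q + t • w := by fun_prop
    simpa using (this.tendsto 0).mono_left nhdsWithin_le_nhds
  obtain ⟨t, ht1, ht2, ht3⟩ :=
    (hw.and ((htend.eventually (hn.2.2 _ hη)).and self_mem_nhdsWithin)).exists
  have ht3 : 0 < t := ht3
  refine ht1 (ht2.1 ?_)
  rw [add_sub_cancel_left, inner_smul_left, norm_smul, Real.norm_of_nonneg ht3.le]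
  simp only [conj_trivial]
  have : (inner ℝ w n : ℝ) / (2 * ‖w‖) * (t * ‖w‖) = t * ((inner ℝ w n : ℝ) / 2) := by
    field_simp
  rw [this]
  nlinarith

theorem eventually_mem_ball_of_inner_pos {y q w : Plane} (hw : 0 < (inner ℝ w (y - q) : ℝ)) :
    ∀ᶠ t in 𝓝[>] (0 : ℝ), q + t • w ∈ Metric.ball y (dist y q) := by
  have hw0 : 0 < ‖w‖ := norm_pos_iff.2 fun h => by simp [h] at hw
  have hsmall : ∀ᶠ t in 𝓝[>] (0 : ℝ), t < 2 * inner ℝ w (y - q) / ‖w‖ ^ 2 :=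
    nhdsWithin_le_nhds (gt_mem_nhds (by positivity))
  filter_upwards [hsmall, self_mem_nhdsWithin] with t ht1 ht2
  have ht2 : 0 < t := ht2
  rw [Metric.mem_ball, dist_eq_norm, dist_eq_norm,
    show q + t • w - y = t • w - (y - q) by abel]
  refine lt_of_pow_lt_pow_left₀ 2 (norm_nonneg _) ?_
  rw [norm_sub_sq_real, norm_smul, Real.norm_of_nonneg ht2.le, inner_smul_left]
  rw [lt_div_iff₀ (by positivity)] at ht1
  simp only [conj_trivial]
  nlinarith

theorem ball_infDist_frontier_subset {y : Plane} (hy : y ∈ Ω) :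
    Metric.ball y (Metric.infDist y (frontier Ω)) ⊆ Ω := by
  intro z hz
  by_contra hzΩ
  have := infDist_frontier_le_of_notMem (s := Ω) (x := y) (y := z) (by tauto)
  rw [Metric.mem_ball, dist_comm] at hz
  linarith

theorem ball_infDist_frontier_disjoint {y : Plane} (hy : y ∉ Ω) {z : Plane}
    (hz : z ∈ Metric.ball y (Metric.infDist y (frontier Ω))) : z ∉ Ω := by
  intro hzΩ
  have := infDist_frontier_le_of_notMem (s := Ω) (x := y) (y := z) (by tauto)
  rw [Metric.mem_ball, dist_comm] at hz
  linarith

theorem IsInnerNormal.eq_of_mem {y q n : Plane} (hn : IsInnerNormal Ω q n)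
    (hq : IsNearest Ω y q) (hy : y ∈ Ω) (hyq : y ≠ q) : n = (‖y - q‖)⁻¹ • (y - q) := by
  have h0 : 0 < ‖y - q‖ := norm_pos_iff.2 (sub_ne_zero.2 hyq)
  refine (eq_of_forall_inner_pos ?_ hn.2.1 fun w hw => hn.inner_nonneg ?_).symm
  · rw [norm_smul, norm_inv, norm_norm, inv_mul_cancel₀ h0.ne']
  · rw [inner_smul_right] at hw
    filter_upwards [eventually_mem_ball_of_inner_pos (pos_of_mul_pos_right hw
      (inv_pos.2 h0).le)] with t ht
    rw [hq.2] at ht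
    exact subset_closure (ball_infDist_frontier_subset hy ht)

theorem IsInnerNormal.eq_of_notMem {y q n : Plane} (hn : IsInnerNormal Ω q n)
    (hq : IsNearest Ω y q) (hy : y ∉ Ω) (hyq : y ≠ q) : n = -((‖y - q‖)⁻¹ • (y - q)) := by
  have h0 : 0 < ‖y - q‖ := norm_pos_iff.2 (sub_ne_zero.2 hyq)
  refine neg_eq_iff_eq_neg.1 (eq_of_forall_inner_pos ?_ (by rw [norm_neg]; exact hn.2.1)
    fun w hw => ?_).symm
  · rw [norm_smul, norm_inv, norm_norm, inv_mul_cancel₀ h0.ne']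
  · rw [inner_neg_right, neg_nonneg]
    refine hn.inner_nonpos ?_
    rw [inner_smul_right] at hw
    filter_upwards [eventually_mem_ball_of_inner_pos (pos_of_mul_pos_right hw
      (inv_pos.2 h0).le)] with t ht
    rw [hq.2] at ht
    exact ball_infDist_frontier_disjoint hy ht

open Classical in
/-- The signed distance at a point off the boundary. -/
theorem hasDerivWithinAt_sdist_of_notMem_frontier (hV : LipschitzWith K V) (hC : ∀ x, ‖V x‖ ≤ C)
    {y : Plane} (hy : y ∉ frontier Ω) (hne : (frontier Ω).Nonempty) {l : ℝ}
    (hnear : ∀ q, IsNearest Ω y q →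
      (if y ∈ Ω then 1 else -1) * (inner ℝ (V q) (q - y) / ‖q - y‖) = l) :
    HasDerivWithinAt (fun ε : ℝ => sdist ((fun x => x + ε • V x) '' Ω) y) l (Set.Ici 0) 0 := by
  set σ : ℝ := if y ∈ Ω then 1 else -1 with hσ
  have hσσ : σ * σ = 1 := by rw [hσ]; split_ifs <;> norm_num
  have hd := hasDerivWithinAt_infDist_perturbation isClosed_frontier hne hV.continuous hC hy
    (l := σ * l) (fun q hq hqd => by rw [← hnear q ⟨hq, hqd⟩, ← mul_assoc, hσσ, one_mul])
  have hd2 := hd.const_mul σ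
  rw [← mul_assoc, hσσ, one_mul] at hd2
  have hpos : 0 < Metric.infDist y (frontier Ω) :=
    (isClosed_frontier.notMem_iff_infDist_pos hne).1 hy
  have hsmall : ∀ᶠ ε in 𝓝 (0 : ℝ), ε * C < Metric.infDist y (frontier Ω) := by
    have h : Tendsto (fun ε : ℝ => ε * C) (𝓝 0) (𝓝 0) := by
      have : Continuous fun ε : ℝ => ε * C := by fun_prop
      simpa using this.tendsto 0
    exact h.eventually (gt_mem_nhds hpos)
  have heq : ∀ ε : ℝ, 0 ≤ ε → |ε| * K < 1 → ε * C < Metric.infDist y (frontier Ω) →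
      sdist ((fun x => x + ε • V x) '' Ω) y =
        σ * Metric.infDist y ((fun x => x + ε • V x) '' frontier Ω) := by
    intro ε h0 hε hεC
    obtain ⟨z, -, hz, hiff⟩ := exists_preimage_perturbation (Ω := Ω) hV hC h0 hε y
    have hzb : z ∈ Metric.ball y (Metric.infDist y (frontier Ω)) := by
      rw [Metric.mem_ball, dist_comm]
      linarith
    rw [sdist, frontier_perturbation hV hε, hiff, hσ]
    by_cases hyΩ : y ∈ Ω
    · rw [if_pos (ball_infDist_frontier_subset hyΩ hzb), if_pos hyΩ, one_mul]
    · rw [if_neg (ball_infDist_frontier_disjoint hyΩ hzb), if_neg hyΩ, neg_one_mul]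
  refine hd2.congr_of_eventuallyEq ?_ (heq 0 le_rfl (by simp) (by simpa using hpos))
  filter_upwards [self_mem_nhdsWithin, nhdsWithin_le_nhds (eventually_abs_mul_lt_one K),
    nhdsWithin_le_nhds hsmall] with ε h1 h2 h3 using heq ε h1 h2 h3

/-- The distance of a boundary point with a normal to the perturbed boundary. -/
theorem abs_infDist_perturbation_sub_le_of_isInnerNormal (hV : LipschitzWith K V)
    (hC : ∀ x, ‖V x‖ ≤ C) (hC0 : 0 < C) (hΩ : IsOpen Ω) {y n : Plane} (hn : IsInnerNormal Ω y n)
    {η r ε : ℝ} (hη : 0 < η) (hη4 : η < 1 / 4)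
    (hr : ∀ w, dist w y < r →
      (η * ‖w - y‖ < inner ℝ (w - y) n → w ∈ Ω) ∧
      (inner ℝ (w - y) n < -(η * ‖w - y‖) → w ∉ closure Ω))
    (hε : 0 < ε) (hεr : 3 * C * ε < r) :
    |Metric.infDist y ((fun x => x + ε • V x) '' frontier Ω) - ε * (|inner ℝ (V y) n|)| ≤
      (4 * η * C + 3 * K * C * ε) * ε := by
  set b : ℝ := inner ℝ (V y) n with hb
  have hnn : inner ℝ n n = (1 : ℝ) := by rw [real_inner_self_eq_norm_sq, hn.2.1, one_pow]
  have hbC : |b| ≤ C := by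
    have := abs_real_inner_le_norm (V y) n
    rw [hn.2.1, mul_one] at this
    exact this.trans (hC y)
  have hVy : ∀ w, ‖V w - V y‖ ≤ K * ‖w - y‖ := fun w => by
    simpa [dist_eq_norm] using hV.dist_le_mul w y
  have hne : (frontier Ω).Nonempty := ⟨y, hn.1⟩
  have hK0 : (0 : ℝ) ≤ K := K.2
  rw [abs_le]
  constructor
  · suffices ε * |b| - (4 * η * C + 3 * K * C * ε) * ε ≤
        Metric.infDist y ((fun x => x + ε • V x) '' frontier Ω) by linarith
    refine (Metric.le_infDist (hne.image _)).2 ?_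
    rintro _ ⟨w, hw, rfl⟩
    rw [dist_comm, dist_eq_norm]
    rw [show w + ε • V w - y = (w - y) + ε • V w by abel]
    have hrest : 0 ≤ (4 * η * C + 3 * K * C * ε) * ε := by positivity
    by_cases hwy : ‖w - y‖ < 2 * C * ε
    · have hwr : dist w y < r := by
        rw [dist_eq_norm]
        nlinarith [mul_pos hC0 hε]
      obtain ⟨h1, h2⟩ := hr w hwr
      have hwΩ : w ∉ Ω := fun h => (hΩ.inter_frontier_eq).subset ⟨h, hw⟩
      have h1 := not_lt.1 (mt h1 hwΩ)
      have h2 : -(η * ‖w - y‖) ≤ inner ℝ (w - y) n := by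
        by_contra! hlt
        exact h2 hlt (frontier_subset_closure hw)
      have h3 : |inner ℝ ((w - y) + ε • V w) n| ≤ ‖(w - y) + ε • V w‖ := by
        have := abs_real_inner_le_norm ((w - y) + ε • V w) n
        rwa [hn.2.1, mul_one] at this
      refine le_trans ?_ h3
      have h4 : |inner ℝ (V w - V y) n| ≤ K * (2 * C * ε) := by
        have := abs_real_inner_le_norm (V w - V y) n
        rw [hn.2.1, mul_one] at this
        exact (this.trans (hVy w)).trans (mul_le_mul_of_nonneg_left hwy.le hK0)
      have h5 : inner ℝ ((w - y) + ε • V w) n =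
          ε * b + (inner ℝ (w - y) n + ε * inner ℝ (V w - V y) n) := by
        rw [inner_add_left, real_inner_smul_left, inner_sub_left (V w), hb]
        ring
      have h6 : |inner ℝ (w - y) n + ε * inner ℝ (V w - V y) n| ≤
          2 * η * C * ε + 2 * K * C * ε * ε := by
        refine (abs_add_le _ _).trans ?_
        rw [abs_mul, abs_of_pos hε]
        have h7 : |inner ℝ (w - y) n| ≤ η * ‖w - y‖ := abs_le.2 ⟨h2, h1⟩
        have h8 := mul_le_mul_of_nonneg_left hwy.le hη.le
        have h9 := mul_le_mul_of_nonneg_left h4 hε.le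
        nlinarith
      rw [h5]
      have h7 := abs_sub_abs_le_abs_sub (ε * b)
        (-(inner ℝ (w - y) n + ε * inner ℝ (V w - V y) n))
      rw [abs_neg, sub_neg_eq_add, abs_mul, abs_of_pos hε] at h7
      have h8 : 0 ≤ η * C * ε := by positivity
      have h9 : 0 ≤ K * C * ε * ε := by positivity
      nlinarith
    · rw [not_lt] at hwy
      have h4 : ‖w - y‖ ≤ ‖(w - y) + ε • V w‖ + ‖ε • V w‖ := by
        simpa using norm_sub_le ((w - y) + ε • V w) (ε • V w)
      rw [norm_smul, Real.norm_of_nonneg hε.le] at h4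
      have h5 := mul_le_mul_of_nonneg_left (hC w) hε.le
      have h6 := mul_le_mul_of_nonneg_left hbC hε.le
      linarith
  · set t : ℝ := 4 * η * C * ε with ht
    have hC1 : 0 < C * ε := mul_pos hC0 hε
    have ht0 : 0 < t := by positivity
    have htC : t ≤ C * ε := by nlinarith
    set w₀ : Plane := y - ε • (V y - b • n) with hw₀
    have hnorm : ‖w₀ - y‖ ≤ 2 * C * ε := by
      rw [hw₀, sub_sub_cancel_left, norm_neg, norm_smul, Real.norm_of_nonneg hε.le]
      have h1 : ‖V y - b • n‖ ≤ 2 * C := by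
        refine (norm_sub_le _ _).trans ?_
        rw [norm_smul, hn.2.1, mul_one, Real.norm_eq_abs]
        linarith [hC y]
      nlinarith
    have hinner : inner ℝ (w₀ - y) n = (0 : ℝ) := by
      rw [hw₀, sub_sub_cancel_left, inner_neg_left, real_inner_smul_left, inner_sub_left,
        real_inner_smul_left, hnn, ← hb]
      ring
    have hside : ∀ s : ℝ, |s| = t → ‖w₀ + s • n - y‖ ≤ 2 * C * ε + t ∧
        inner ℝ (w₀ + s • n - y) n = s := by
      intro s hs
      rw [show w₀ + s • n - y = (w₀ - y) + s • n by abel]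
      constructor
      · refine (norm_add_le _ _).trans ?_
        rw [norm_smul, hn.2.1, mul_one, Real.norm_eq_abs, hs]
        linarith
      · rw [inner_add_left, hinner, real_inner_smul_left, hnn]
        ring
    have hlt : η * (2 * C * ε + t) < t := by nlinarith
    obtain ⟨hp1, hp2⟩ := hside t (abs_of_pos ht0)
    obtain ⟨hm1, hm2⟩ := hside (-t) (by rw [abs_neg, abs_of_pos ht0])
    have hP : w₀ + t • n ∈ Ω := by
      refine (hr _ (by rw [dist_eq_norm]; linarith)).1 ?_
      rw [hp2]
      exact (mul_le_mul_of_nonneg_left hp1 hη.le).trans_lt hlt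
    have hQ : w₀ + (-t) • n ∉ Ω := by
      refine fun h => (hr _ (by rw [dist_eq_norm]; linarith)).2 ?_ (subset_closure h)
      rw [hm2, neg_lt_neg_iff]
      exact (mul_le_mul_of_nonneg_left hm1 hη.le).trans_lt hlt
    obtain ⟨w, hw, hwΓ⟩ := exists_mem_frontier_of_segment hP hQ
    have hww₀ : ‖w - w₀‖ ≤ t := by
      have hsub : segment ℝ (w₀ + t • n) (w₀ + (-t) • n) ⊆ Metric.closedBall w₀ t := by
        refine (convex_closedBall w₀ t).segment_subset ?_ ?_ <;>
        · rw [Metric.mem_closedBall, dist_self_add_left, norm_smul, hn.2.1, mul_one]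
          simp [abs_of_pos ht0]
      simpa [dist_eq_norm] using hsub hw
    have hwy : ‖w - y‖ ≤ 3 * C * ε := by
      have := norm_add_le (w - w₀) (w₀ - y)
      rw [sub_add_sub_cancel] at this
      linarith
    have h1 := Metric.infDist_le_dist_of_mem (x := y)
      (Set.mem_image_of_mem (fun x => x + ε • V x) hwΓ)
    rw [dist_comm, dist_eq_norm] at h1
    have h2 : w + ε • V w - y = (w - w₀) + ((ε * b) • n + ε • (V w - V y)) := by
      rw [hw₀]
      module
    rw [h2] at h1
    have h3 := norm_add_le (w - w₀) ((ε * b) • n + ε • (V w - V y))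
    have h4 := norm_add_le ((ε * b) • n) (ε • (V w - V y))
    rw [norm_smul, hn.2.1, mul_one, norm_smul, Real.norm_eq_abs, Real.norm_eq_abs, abs_mul,
      abs_of_pos hε] at h4
    have h5 := mul_le_mul_of_nonneg_left ((hVy w).trans (mul_le_mul_of_nonneg_left hwy hK0)) hε.le
    nlinarith

/-- The signed distance at a boundary point with a normal. -/
theorem hasDerivWithinAt_sdist_of_isInnerNormal (hV : LipschitzWith K V) (hC : ∀ x, ‖V x‖ ≤ C)
    (hC0 : 0 < C) (hΩ : IsOpen Ω) {y n : Plane} (hn : IsInnerNormal Ω y n) :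
    HasDerivWithinAt (fun ε : ℝ => sdist ((fun x => x + ε • V x) '' Ω) y) (-inner ℝ (V y) n)
      (Set.Ici 0) 0 := by
  set b : ℝ := inner ℝ (V y) n with hb
  have hK0 : (0 : ℝ) ≤ K := K.2
  have hyΩ : y ∉ Ω := fun h => (hΩ.inter_frontier_eq).subset ⟨h, hn.1⟩
  refine hasDerivWithinAt_Ici_zero_of_eventually_abs_le fun κ hκ => ?_
  obtain ⟨η, hη, hη4, hηκ, hηb⟩ : ∃ η : ℝ, 0 < η ∧ η < 1 / 4 ∧ 8 * η * C ≤ κ ∧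
      (b ≠ 0 → 4 * η * C ≤ |b|) := by
    by_cases hb0 : b = 0
    · refine ⟨min (1 / 8) (κ / (8 * C)), by positivity,
        (min_le_left _ _).trans_lt (by norm_num), ?_, fun h => absurd hb0 h⟩
      have := min_le_right (1 / 8) (κ / (8 * C))
      rw [le_div_iff₀ (by positivity)] at this
      linarith
    · have hbpos : 0 < |b| := abs_pos.2 hb0
      refine ⟨min (1 / 8) (min (κ / (8 * C)) (|b| / (4 * C))), by positivity,
        (min_le_left _ _).trans_lt (by norm_num), ?_, fun _ => ?_⟩
      · have := (min_le_right (1 / 8) _).trans (min_le_left (κ / (8 * C)) (|b| / (4 * C)))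
        rw [le_div_iff₀ (by positivity)] at this
        linarith
      · have := (min_le_right (1 / 8) _).trans (min_le_right (κ / (8 * C)) (|b| / (4 * C)))
        rw [le_div_iff₀ (by positivity)] at this
        linarith
  obtain ⟨r, hr0, hr⟩ := Metric.eventually_nhds_iff.1 (hn.2.2 η hη)
  have hlin : ∀ (A B : ℝ), 0 < B → ∀ᶠ ε in 𝓝[>] (0 : ℝ), A * ε < B := fun A B hB => by
    have h : Tendsto (fun ε : ℝ => A * ε) (𝓝 0) (𝓝 0) := by
      have : Continuous fun ε : ℝ => A * ε := by fun_prop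
      simpa using this.tendsto 0
    exact nhdsWithin_le_nhds (h.eventually (gt_mem_nhds hB))
  have hKb : ∀ᶠ ε in 𝓝[>] (0 : ℝ), b ≠ 0 → 2 * K * C * ε < |b| := by
    by_cases hb0 : b = 0
    · exact Eventually.of_forall fun ε h => absurd hb0 h
    · filter_upwards [hlin (2 * K * C) |b| (abs_pos.2 hb0)] with ε h _ using h
  filter_upwards [self_mem_nhdsWithin, nhdsWithin_le_nhds (eventually_abs_mul_lt_one K),
    hlin (3 * C) r hr0, hlin (6 * K * C) κ hκ, hKb] with ε h1 h2 h3 h4 h5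
  have h1 : 0 < ε := h1
  have hmain := abs_infDist_perturbation_sub_le_of_isInnerNormal hV hC hC0 hΩ hn hη hη4
    (fun w hw => hr hw) h1 h3
  rw [← hb] at hmain
  have herr : (4 * η * C + 3 * K * C * ε) * ε ≤ κ * ε := by
    refine mul_le_mul_of_nonneg_right ?_ h1.le
    linarith
  replace hmain := hmain.trans herr
  have h0 : sdist ((fun x => x + (0 : ℝ) • V x) '' Ω) y = 0 := by
    simp [sdist, hyΩ, Metric.infDist_zero_of_mem hn.1]
  obtain ⟨z, hzy, hz, hiff⟩ := exists_preimage_perturbation (Ω := Ω) hV hC h1.le h2 y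
  rw [h0, sub_zero, sdist, frontier_perturbation hV h2, hiff]
  set D := Metric.infDist y ((fun x => x + ε • V x) '' frontier Ω)
  have hzy' : z - y = -(ε • V z) := by rw [← hzy]; abel
  have hznorm : ‖z - y‖ ≤ ε * C := by rwa [← dist_eq_norm, dist_comm]
  have hzr : dist z y < r := by
    rw [dist_eq_norm]
    nlinarith [mul_pos h1 hC0]
  have hzin : |inner ℝ (z - y) n + ε * b| ≤ ε * (K * (ε * C)) := by
    have e1 : inner ℝ (z - y) n + ε * b = -(ε * inner ℝ (V z - V y) n) := by
      rw [hzy', inner_neg_left, real_inner_smul_left, inner_sub_left, hb]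
      ring
    rw [e1, abs_neg, abs_mul, abs_of_pos h1]
    refine mul_le_mul_of_nonneg_left ?_ h1.le
    have := abs_real_inner_le_norm (V z - V y) n
    rw [hn.2.1, mul_one] at this
    refine this.trans ?_
    have h6 := hV.dist_le_mul z y
    rw [dist_eq_norm, dist_eq_norm] at h6
    exact h6.trans (mul_le_mul_of_nonneg_left hznorm hK0)
  have hηz : η * ‖z - y‖ ≤ ε * (η * C) := by
    have := mul_le_mul_of_nonneg_left hznorm hη.le
    linarith
  rw [abs_le] at hzin
  rcases lt_trichotomy b 0 with hb0 | hb0 | hb0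
  · have e1 := hηb hb0.ne
    have e2 := h5 hb0.ne
    rw [abs_of_neg hb0] at e1 e2
    have hzΩ : z ∈ Ω := by
      refine (hr hzr).1 ?_
      have e3 : ε * (η * C + K * (ε * C)) < ε * (-b) := by
        refine mul_lt_mul_of_pos_left ?_ h1
        linarith
      linarith
    rw [if_pos hzΩ]
    rw [abs_of_neg hb0] at hmain
    simpa using hmain
  · have hD : 0 ≤ D := Metric.infDist_nonneg
    rw [hb0, abs_zero, mul_zero, sub_zero, abs_of_nonneg hD] at hmain
    rw [hb0, neg_zero, mul_zero, sub_zero]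
    split_ifs
    · rwa [abs_of_nonneg hD]
    · rwa [abs_neg, abs_of_nonneg hD]
  · have e1 := hηb hb0.ne'
    have e2 := h5 hb0.ne'
    rw [abs_of_pos hb0] at e1 e2
    have hzΩ : z ∉ Ω := by
      refine fun h => (hr hzr).2 ?_ (subset_closure h)
      have e3 : ε * (η * C + K * (ε * C)) < ε * b := by
        refine mul_lt_mul_of_pos_left ?_ h1
        linarith
      linarith
    rw [if_neg hzΩ]
    rw [abs_of_pos hb0, ← abs_neg] at hmain
    rwa [show -D - ε * -b = -(D - ε * b) by ring]

end Perturbed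

/-! ### The smoothed maximum -/

theorem hasDerivAt_max_zero_sq (x : ℝ) :
    HasDerivAt (fun x : ℝ => max 0 x ^ 2) (2 * max 0 x) x := by
  rcases lt_trichotomy x 0 with hx | rfl | hx
  · rw [max_eq_left hx.le, mul_zero]
    refine (hasDerivAt_const x (0 : ℝ)).congr_of_eventuallyEq ?_
    filter_upwards [gt_mem_nhds hx] with z hz
    simp [max_eq_left (show z ≤ 0 from hz.le)]
  · rw [hasDerivAt_iff_isLittleO, Asymptotics.isLittleO_iff]
    intro c hc
    filter_upwards [Metric.ball_mem_nhds (0 : ℝ) hc] with z hz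
    rw [Metric.mem_ball, dist_zero_right, Real.norm_eq_abs] at hz
    have h1 : max 0 z ≤ |z| := max_le (abs_nonneg z) (le_abs_self z)
    have h2 : 0 ≤ max 0 z := le_max_left _ _
    simp only [max_self, mul_zero, smul_zero, sub_zero, ne_eq, OfNat.ofNat_ne_zero,
      not_false_eq_true, zero_pow, norm_pow, Real.norm_eq_abs, abs_of_nonneg h2]
    nlinarith [abs_nonneg z]
  · rw [max_eq_right hx.le]
    have h : HasDerivAt (fun x : ℝ => x ^ 2) (2 * x) x := by simpa using hasDerivAt_pow 2 x
    refine h.congr_of_eventuallyEq ?_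
    filter_upwards [lt_mem_nhds hx] with z hz
    rw [max_eq_right (show (0 : ℝ) ≤ z from hz.le)]

theorem smax_eq {h α : ℝ} (hα : 0 < α) (d : ℝ) :
    smax h α d =
      α / 4 * (max 0 (1 - d / h + 1 / α) ^ 2 - max 0 (1 - d / h - 1 / α) ^ 2) := by
  unfold smax
  set t := 1 - d / h
  have h1 : 0 < 1 / α := by positivity
  split_ifs with hc
  · rw [max_eq_right (by linarith), max_eq_left (by linarith)]
    field_simp
    ring
  · rcases le_total t (-(1 / α)) with hle | hle
    · rw [max_eq_left (by linarith), max_eq_left (by linarith), max_eq_left (by linarith)]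
      ring
    · have : 1 / α < t := by
        by_contra! hcon
        exact hc ⟨hle, hcon⟩
      rw [max_eq_right (by linarith), max_eq_right (by linarith), max_eq_right (by linarith)]
      field_simp
      ring

theorem smaxDeriv_eq {h α : ℝ} (hh : 0 < h) (hα : 0 < α) (d : ℝ) :
    smaxDeriv h α d =
      α / 4 * (2 * max 0 (1 - d / h + 1 / α) * -(1 / h) -
        2 * max 0 (1 - d / h - 1 / α) * -(1 / h)) := by
  unfold smaxDeriv
  set t := 1 - d / h
  have h1 : 0 < 1 / α := by positivity
  split_ifs with hc1 hc2
  · rw [max_eq_left (by linarith), max_eq_left (by linarith)]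
    ring
  · rw [max_eq_right (by linarith), max_eq_left (by linarith)]
    field_simp
    ring
  · rw [max_eq_right (by linarith), max_eq_right (by linarith)]
    field_simp
    ring

theorem hasDerivAt_smax {h α : ℝ} (hh : 0 < h) (hα : 0 < α) (d : ℝ) :
    HasDerivAt (smax h α) (smaxDeriv h α d) d := by
  rw [show smax h α = _ from funext (smax_eq hα), smaxDeriv_eq hh hα]
  have ht : ∀ s : ℝ, HasDerivAt (fun d => 1 - d / h + s) (-(1 / h)) d := fun s =>
    (((hasDerivAt_id d).div_const h).const_sub 1).add_const s
  have h1 := (hasDerivAt_max_zero_sq (1 - d / h + 1 / α)).comp d (ht (1 / α))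
  have h2 := (hasDerivAt_max_zero_sq (1 - d / h + -(1 / α))).comp d (ht (-(1 / α)))
  simpa only [← sub_eq_add_neg, Function.comp_def, Pi.sub_apply] using (h1.sub h2).const_mul (α / 4)

/-! ### The perturbation field of a setup -/

namespace Setup

variable {N : ℕ} (P : Setup N)

theorem exists_lipschitzWith_V (hcont : Continuous (P.mesh.ansatz 1 P.vtx)) :
    ∃ K, LipschitzWith K P.V := by
  obtain ⟨K, hK⟩ := P.mesh.exists_lipschitzWith_hat hcont
  refine ⟨K * ‖P.dx‖₊, LipschitzWith.of_dist_le_mul fun x y => ?_⟩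
  rw [dist_eq_norm, V, V, ← sub_smul, norm_smul, ← dist_eq_norm]
  push_cast
  rw [mul_right_comm]
  exact mul_le_mul_of_nonneg_right (hK.dist_le_mul x y) (norm_nonneg _)

theorem norm_V_le (hcont : Continuous (P.mesh.ansatz 1 P.vtx)) (x : Plane) :
    ‖P.V x‖ ≤ ‖P.dx‖ := by
  obtain ⟨h0, h1⟩ := P.mesh.hat_mem_Icc hcont x
  rw [V, norm_smul, Real.norm_of_nonneg h0]
  exact mul_le_of_le_one_left (norm_nonneg _) h1

theorem φ_zero : P.φ 0 = id := by
  funext x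
  simp [φ]

theorem dom_zero : P.dom 0 = P.Ω := by
  simp [dom, φ_zero]

theorem nearest_proj {y : Plane} (hne : (frontier P.Ω).Nonempty) :
    IsNearest P.Ω y (proj P.Ω y) := by
  obtain ⟨q, hq, hd⟩ := isClosed_frontier.exists_infDist_eq_dist hne y
  have h : ∃ q, IsNearest P.Ω y q := ⟨q, hq, hd.symm⟩
  rw [proj, dif_pos h]
  exact h.choose_spec

theorem isInnerNormal_unitNormal {Ω : Set Plane} {q : Plane} (h : ∃ n, IsInnerNormal Ω q n) :
    IsInnerNormal Ω q (unitNormal Ω q) := by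
  rw [unitNormal, dif_pos h]
  exact h.choose_spec

/-- The shape derivative of the signed distance. -/
theorem hasDerivWithinAt_sdist {K : NNReal} (hV : LipschitzWith K P.V) {C : ℝ}
    (hC : ∀ x, ‖P.V x‖ ≤ C) (hC0 : 0 < C) (hΩ : IsOpen P.Ω) {y : Plane}
    (hreg : ∀ q, IsNearest P.Ω y q → P.V q ≠ 0 →
      (∀ q', IsNearest P.Ω y q' → q' = q) ∧ ∃ n, IsInnerNormal P.Ω q n) :
    HasDerivWithinAt (fun ε => sdist (P.dom ε) y)
      (-inner ℝ (P.V (proj P.Ω y)) (unitNormal P.Ω (proj P.Ω y))) (Set.Ici 0) 0 := by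
  have hdom : ∀ ε, P.dom ε = (fun x => x + ε • P.V x) '' P.Ω := fun ε => rfl
  have hlt := eventually_abs_mul_lt_one K
  rcases (frontier P.Ω).eq_empty_or_nonempty with hempty | hne
  · have hn : unitNormal P.Ω (proj P.Ω y) = 0 := by
      rw [unitNormal, dif_neg]
      rintro ⟨n, hn, -⟩
      simp [hempty] at hn
    rw [hn, inner_zero_right, neg_zero]
    refine (hasDerivWithinAt_const (0 : ℝ) (Set.Ici 0) (0 : ℝ)).congr_of_eventuallyEq ?_ ?_
    · filter_upwards [nhdsWithin_le_nhds hlt] with ε hε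
      simp [sdist, hdom, frontier_perturbation hV hε, hempty]
    · simp [sdist, dom_zero, hempty]
  have hproj := P.nearest_proj (y := y) hne
  by_cases hy : y ∈ frontier P.Ω
  · have hpy : proj P.Ω y = y := by
      have := hproj.2
      rw [Metric.infDist_zero_of_mem hy] at this
      exact (dist_eq_zero.1 this).symm
    rw [hpy] at hproj ⊢
    by_cases hVy : P.V y = 0
    · rw [hVy, inner_zero_left, neg_zero]
      have hyΩ : y ∉ P.Ω := fun h => (hΩ.inter_frontier_eq).subset ⟨h, hy⟩
      have heq : ∀ ε : ℝ, |ε| * K < 1 → sdist (P.dom ε) y = 0 := by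
        intro ε hε
        have hfix : (fun x => x + ε • P.V x) y = y := by simp [hVy]
        have h1 : y ∈ frontier (P.dom ε) := by
          rw [hdom, frontier_perturbation hV hε]
          exact ⟨y, hy, hfix⟩
        simp [sdist, Metric.infDist_zero_of_mem h1]
      refine (hasDerivWithinAt_const (0 : ℝ) (Set.Ici 0) (0 : ℝ)).congr_of_eventuallyEq ?_
        (heq 0 (by simp))
      filter_upwards [nhdsWithin_le_nhds hlt] with ε hε using heq ε hε
    · exact hasDerivWithinAt_sdist_of_isInnerNormal hV hC hC0 hΩ
        (isInnerNormal_unitNormal (hreg y hproj hVy).2)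
  · refine hasDerivWithinAt_sdist_of_notMem_frontier hV hC hy hne fun q hq => ?_
    set p := proj P.Ω y
    by_cases hVp : P.V p = 0
    · have hVq : P.V q = 0 := by
        by_contra hVq
        exact hVq ((hreg q hq hVq).1 p hproj ▸ hVp)
      simp [hVp, hVq]
    · obtain ⟨huniq, hn⟩ := hreg p hproj hVp
      have hn := isInnerNormal_unitNormal hn
      rw [huniq q hq]
      have hyq : y ≠ p := fun h => hy (h ▸ hproj.1)
      by_cases hyΩ : y ∈ P.Ω
      · rw [if_pos hyΩ, hn.eq_of_mem hproj hyΩ hyq, inner_smul_right, norm_sub_rev,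
          ← neg_sub y p, inner_neg_right]
        field_simp
      · rw [if_neg hyΩ, hn.eq_of_notMem hproj hyΩ hyq, inner_neg_right, inner_smul_right,
          norm_sub_rev, ← neg_sub y p, inner_neg_right]
        field_simp

/-- The shape derivative of the smoothed boundary term. -/
theorem hasDerivWithinAt_γ (hcont : Continuous (P.mesh.ansatz 1 P.vtx)) (hh : 0 < P.h)
    (hα : 0 < P.α) (hΩ : IsOpen P.Ω) {y : Plane} (hreg : P.Regular y) :
    HasDerivWithinAt (fun ε => P.γ ε y) (P.dγ y) (Set.Ici 0) 0 := by
  obtain ⟨K, hV⟩ := P.exists_lipschitzWith_V hcont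
  have hC : ∀ x, ‖P.V x‖ ≤ ‖P.dx‖ + 1 := fun x => by linarith [P.norm_V_le hcont x]
  have hC0 : 0 < ‖P.dx‖ + 1 := by positivity
  refine HasDerivWithinAt.const_mul P.cγ ?_
  have hs := hasDerivAt_smax hh hα (sdist P.Ω y)
  by_cases h0 : smaxDeriv P.h P.α (sdist P.Ω y) = 0
  · rw [h0] at hs
    rw [h0, zero_mul]
    have hO : (fun ε => sdist (P.dom ε) y - sdist P.Ω y) =O[𝓝[≥] 0] fun ε : ℝ => ε - 0 := by
      refine Asymptotics.IsBigO.of_bound (3 * (‖P.dx‖ + 1)) ?_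
      filter_upwards [nhdsWithin_le_nhds (eventually_abs_mul_lt_one K), self_mem_nhdsWithin]
        with ε h1 h2
      have h2 : 0 ≤ ε := h2
      have := abs_sdist_perturbation_sub_le (Ω := P.Ω) hV hC y h2 h1
      rw [sub_zero, Real.norm_of_nonneg h2, Real.norm_eq_abs]
      calc _ ≤ _ := this
        _ = _ := by ring
    have ht : Tendsto (fun ε => sdist (P.dom ε) y) (𝓝[≥] 0) (𝓝 (sdist P.Ω y)) := by
      rw [tendsto_iff_norm_sub_tendsto_zero]
      refine (hO.trans_tendsto ?_).norm.trans (by simp)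
      exact (Continuous.tendsto' (by fun_prop) 0 0 (by simp)).mono_left nhdsWithin_le_nhds
    rw [hasDerivWithinAt_iff_isLittleO]
    rw [hasDerivAt_iff_isLittleO] at hs
    have h3 := (hs.comp_tendsto ht).trans_isBigO hO
    simpa [Function.comp_def, dom_zero] using h3
  · have hD := P.hasDerivWithinAt_sdist hV hC hC0 hΩ (hreg h0)
    have hs' : HasDerivAt (smax P.h P.α) (smaxDeriv P.h P.α (sdist P.Ω y))
        (sdist (P.dom 0) y) := by rwa [dom_zero]
    exact hs'.comp_hasDerivWithinAt 0 hD

end Setup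

/-- The derivative of `∇ (f ∘ ψ)` for the rank-one shear `ψ w = w - s (⟪e, w⟫ + k) d`. -/
noncomputable def shearGradient (f : Plane → ℝ) (e d : Plane) (k s : ℝ) (w : Plane) : Plane :=
  gradient f (w - (s * (inner ℝ e w + k)) • d) -
    (s * inner ℝ d (gradient f (w - (s * (inner ℝ e w + k)) • d))) • e

theorem hasGradientAt_shear {f : Plane → ℝ} (hf : Differentiable ℝ f) (e d : Plane) (k s : ℝ)
    (w : Plane) : HasGradientAt (fun w => f (w - (s * (inner ℝ e w + k)) • d))
      (shearGradient f e d k s w) w := by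
  have h1 : HasFDerivAt (fun w : Plane => w - (s * (inner ℝ e w + k)) • d)
      (ContinuousLinearMap.id ℝ Plane - (s • innerSL ℝ e).smulRight d) w := by
    refine (hasFDerivAt_id w).sub (HasFDerivAt.smul_const ?_ d)
    exact (((innerSL ℝ e).hasFDerivAt (x := w)).add_const k).const_mul s
  have h2 := ((hf _).hasGradientAt.hasFDerivAt).comp w h1
  rw [hasGradientAt_iff_hasFDerivAt]
  refine h2.congr_fderiv ?_
  ext v
  simp only [shearGradient, ContinuousLinearMap.comp_apply, InnerProductSpace.toDual_apply_apply,
    _root_.sub_apply, ContinuousLinearMap.id_apply,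
    ContinuousLinearMap.smulRight_apply, _root_.smul_apply, innerSL_apply_apply,
    inner_sub_left, inner_sub_right, real_inner_smul_left, real_inner_smul_right, smul_eq_mul]
  rw [real_inner_comm d]
  ring

theorem contDiff_gradient {f : Plane → ℝ} (hf : ContDiff ℝ (⊤ : ℕ∞) f) :
    ContDiff ℝ (⊤ : ℕ∞) (gradient f) :=
  (InnerProductSpace.toDual ℝ Plane).symm.contDiff.comp (hf.fderiv_right le_rfl)

theorem hasDerivWithinAt_shearGradient {f : Plane → ℝ} (hf : ContDiff ℝ (⊤ : ℕ∞) f)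
    (e d : Plane) (k : ℝ) {s : ℝ → ℝ} {w : ℝ → Plane} {w' : Plane} {S : Set ℝ}
    (hs0 : s 0 = 0) (hs : HasDerivWithinAt s 1 S 0) (hw : HasDerivWithinAt w w' S 0) :
    HasDerivWithinAt (fun ε => shearGradient f e d k (s ε) (w ε))
      (fderiv ℝ (gradient f) (w 0) (w' - (inner ℝ e (w 0) + k) • d) -
        (inner ℝ d (gradient f (w 0)) : ℝ) • e) S 0 := by
  have hl : HasDerivWithinAt (fun ε => inner ℝ e (w ε) + k) (inner ℝ e w') S 0 := by
    simpa using ((hasDerivWithinAt_const (0 : ℝ) S e).inner ℝ hw).add_const k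
  have hr : HasDerivWithinAt (fun ε => w ε - (s ε * (inner ℝ e (w ε) + k)) • d)
      (w' - (inner ℝ e (w 0) + k) • d) S 0 := by
    refine (hw.fun_sub ((hs.fun_mul hl).smul_const d)).congr_deriv ?_
    simp [hs0]
  have hg : HasDerivWithinAt
      (fun ε => gradient f (w ε - (s ε * (inner ℝ e (w ε) + k)) • d))
      (fderiv ℝ (gradient f) (w 0) (w' - (inner ℝ e (w 0) + k) • d)) S 0 := by
    have hd : HasFDerivAt (gradient f) (fderiv ℝ (gradient f) (w 0))
        (w 0 - (s 0 * (inner ℝ e (w 0) + k)) • d) := by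
      rw [hs0, zero_mul, zero_smul, sub_zero]
      exact ((contDiff_gradient hf).differentiable (by simp) _).hasFDerivAt
    exact hd.comp_hasDerivWithinAt (0 : ℝ) hr
  have hi := (hasDerivWithinAt_const (0 : ℝ) S d).inner ℝ hg
  refine (hg.fun_sub ((hs.fun_mul hi).smul_const e)).congr_deriv ?_
  simp [hs0]

namespace Setup

variable {N : ℕ} (P : Setup N)

/-- Near `y`, the perturbation field is affine in a direction `dx`, and the ansatz functions are
smooth. -/
structure LocalForm (y : Plane) where
  /-- the gradient of the hat function -/
  e : Plane
  /-- the constant part of the hat function -/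
  k : ℝ
  /-- the smooth functions that coincide with the ansatz functions near `y` -/
  shape : Plane → Plane → ℝ
  contDiff : ∀ a, ContDiff ℝ (⊤ : ℕ∞) (shape a)
  eventually_V : ∀ᶠ z in 𝓝 y, P.V z = (inner ℝ e z + k) • P.dx
  eventually_ansatz : ∀ᶠ z in 𝓝 y, ∀ a, P.mesh.ansatz P.p a z = shape a z
  outflow : (e = 0 ∧ k = 0) ∨ ∀ a, P.γL a = 0 ∨ shape a = fun _ => 0

theorem nonempty_localForm
    (hout : ∀ c ∈ P.mesh.cells, P.vtx ∈ Set.range c →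
      ∀ β ∈ multiIdx P.p, P.γL (localNode P.p c β) = 0)
    {y : Plane} (hy : ∀ c ∈ P.mesh.cells, y ∉ frontier (hull c)) :
    Nonempty (P.LocalForm y) := by
  by_cases h : ∃ c ∈ P.mesh.cells, y ∈ hull c
  · obtain ⟨c, hc, hyc⟩ := h
    have hint : y ∈ interior (hull c) := by
      by_contra hcon
      exact hy c hc ⟨subset_closure hyc, hcon⟩
    have hnhds : ∀ᶠ z in 𝓝 y, z ∈ interior (hull c) := isOpen_interior.mem_nhds hint
    by_cases hv : P.vtx ∈ Set.range c
    · obtain ⟨e, k, hek⟩ := exists_cellAnsatz_one_eq c P.vtx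
      refine ⟨⟨e, k, cellAnsatz P.p c, fun a => contDiff_cellAnsatz _ _ _, ?_, ?_, Or.inr ?_⟩⟩
      · filter_upwards [hnhds] with z hz
        rw [V, P.mesh.ansatz_of_mem_interior 1 hc _ hz, hek]
      · filter_upwards [hnhds] with z hz a
        exact P.mesh.ansatz_of_mem_interior P.p hc a hz
      · intro a
        by_cases ha : P.γL a = 0
        · exact Or.inl ha
        · refine Or.inr (funext fun x => Finset.sum_eq_zero fun β hβ => if_neg ?_)
          rintro rfl
          exact ha (hout c hc hv β hβ)
    · refine ⟨⟨0, 0, cellAnsatz P.p c, fun a => contDiff_cellAnsatz _ _ _, ?_, ?_,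
        Or.inl ⟨rfl, rfl⟩⟩⟩
      · filter_upwards [hnhds] with z hz
        rw [V, P.mesh.ansatz_of_mem_interior 1 hc _ hz, cellAnsatz_one_of_notMem hv]
        simp
      · filter_upwards [hnhds] with z hz a
        exact P.mesh.ansatz_of_mem_interior P.p hc a hz
  · have hnhds : ∀ᶠ z in 𝓝 y, ∀ c ∈ P.mesh.cells, z ∉ hull c := by
      rw [Filter.eventually_all_finset]
      intro c hc
      exact (isClosed_hull c).isOpen_compl.mem_nhds fun hyc => h ⟨c, hc, hyc⟩
    refine ⟨⟨0, 0, fun _ _ => 0, fun a => contDiff_const, ?_, ?_, Or.inl ⟨rfl, rfl⟩⟩⟩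
    · filter_upwards [hnhds] with z hz
      rw [V, P.mesh.ansatz_of_notMem 1 _ hz]
      simp
    · filter_upwards [hnhds] with z hz a
      exact P.mesh.ansatz_of_notMem P.p a hz

/-- The finite-element function on the perturbed mesh with coefficients `C ε a`. -/
noncomputable def interpWith (C : ℝ → Plane → ℝ) (ε : ℝ) (y : Plane) : ℝ :=
  ∑ a ∈ P.mesh.nodes P.p, C ε a * P.ansatzE ε a y

theorem interp_eq : P.interp = P.interpWith P.γ := rfl

theorem ρD_eq : P.ρD = P.interpWith fun ε a => P.m * P.γ ε a + P.m * P.γL a := by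
  funext ε y
  rw [ρD, interpWith, ← Finset.sum_add_distrib]
  exact Finset.sum_congr rfl fun a _ => by ring

theorem ansatzE_zero (a y : Plane) : P.ansatzE 0 a y = P.mesh.ansatz P.p a y := by
  have h : Function.invFun (P.φ 0) y = y := by
    rw [φ_zero]
    exact Function.leftInverse_invFun Function.injective_id y
  rw [ansatzE, h]

namespace LocalForm

variable {P} {y : Plane} (A : P.LocalForm y)

/-- The coefficient in the inverse of the local deformation. -/
noncomputable def coef (ε : ℝ) : ℝ := ε / (1 + ε * inner ℝ A.e P.dx)

theorem coef_zero : A.coef 0 = 0 := by simp [coef]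

theorem hasDerivAt_coef : HasDerivAt A.coef 1 0 := by
  have h1 : HasDerivAt (fun ε : ℝ => 1 + ε * inner ℝ A.e P.dx) (inner ℝ A.e P.dx) 0 := by
    simpa using ((hasDerivAt_id (0 : ℝ)).mul_const (inner ℝ A.e P.dx : ℝ)).const_add 1
  refine ((hasDerivAt_id (0 : ℝ)).fun_div h1 (by simp)).congr_deriv ?_
  simp

theorem tendsto_inverse : Tendsto (fun q : ℝ × Plane =>
    q.2 - (A.coef q.1 * (inner ℝ A.e q.2 + A.k)) • P.dx) (𝓝 (0, y)) (𝓝 y) := by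
  have hcoef : ContinuousAt (fun q : ℝ × Plane => A.coef q.1) (0, y) :=
    ContinuousAt.comp (g := A.coef) (f := Prod.fst) A.hasDerivAt_coef.continuousAt
      continuousAt_fst
  have hin : Continuous fun q : ℝ × Plane => inner ℝ A.e q.2 + A.k :=
    (continuous_const.inner continuous_snd).add continuous_const
  have h : ContinuousAt (fun q : ℝ × Plane =>
      q.2 - (A.coef q.1 * (inner ℝ A.e q.2 + A.k)) • P.dx) (0, y) :=
    continuousAt_snd.sub ((hcoef.mul hin.continuousAt).smul continuousAt_const)
  simpa [ContinuousAt, A.coef_zero] using h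

theorem eventually_invFun {K : NNReal} (hV : LipschitzWith K P.V) :
    ∀ᶠ q : ℝ × Plane in 𝓝 (0, y), Function.invFun (P.φ q.1) q.2 =
      q.2 - (A.coef q.1 * (inner ℝ A.e q.2 + A.k)) • P.dx := by
  have hden : ∀ᶠ q : ℝ × Plane in 𝓝 (0, y), 1 + q.1 * inner ℝ A.e P.dx ≠ 0 := by
    have hc : Continuous fun q : ℝ × Plane => 1 + q.1 * inner ℝ A.e P.dx := by fun_prop
    exact hc.continuousAt.eventually_ne (by simp)
  have hlt : ∀ᶠ q : ℝ × Plane in 𝓝 (0, y), |q.1| * K < 1 :=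
    (continuous_fst.tendsto ((0 : ℝ), y)).eventually (eventually_abs_mul_lt_one K)
  filter_upwards [A.tendsto_inverse.eventually A.eventually_V, hden, hlt] with q h1 h2 h3
  have hinj : Function.Injective (P.φ q.1) := (isHomeomorph_perturbation hV h3).bijective.1
  set z := q.2 - (A.coef q.1 * (inner ℝ A.e q.2 + A.k)) • P.dx with hz
  have hφ : P.φ q.1 z = q.2 := by
    have hinz : inner ℝ A.e z = inner ℝ A.e q.2 -
        A.coef q.1 * (inner ℝ A.e q.2 + A.k) * inner ℝ A.e P.dx := by
      rw [hz, inner_sub_right, real_inner_smul_right]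
    have hs : q.1 * (inner ℝ A.e z + A.k) = A.coef q.1 * (inner ℝ A.e q.2 + A.k) := by
      rw [hinz, coef]
      field_simp
      ring
    rw [φ, h1, smul_smul, hs, hz, sub_add_cancel]
  conv_lhs => rw [← hφ]
  exact Function.leftInverse_invFun hinj z

theorem eventually_ansatzE {K : NNReal} (hV : LipschitzWith K P.V) :
    ∀ᶠ q : ℝ × Plane in 𝓝 (0, y), ∀ a, P.ansatzE q.1 a q.2 =
      A.shape a (q.2 - (A.coef q.1 * (inner ℝ A.e q.2 + A.k)) • P.dx) := by
  filter_upwards [A.eventually_invFun hV, A.tendsto_inverse.eventually A.eventually_ansatz] with q h1 h2 a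
  rw [ansatzE, h1, h2 a]

theorem eventually_gradient_interpWith {K : NNReal} (hV : LipschitzWith K P.V)
    (C : ℝ → Plane → ℝ) :
    ∀ᶠ q : ℝ × Plane in 𝓝 (0, y), gradient (P.interpWith C q.1) q.2 =
      ∑ a ∈ P.mesh.nodes P.p,
        C q.1 a • shearGradient (A.shape a) A.e P.dx A.k (A.coef q.1) q.2 := by
  filter_upwards [(A.eventually_ansatzE hV).eventually_nhds] with q hq
  have hc : Tendsto (fun w : Plane => (q.1, w)) (𝓝 q.2) (𝓝 q) :=
    (Continuous.prodMk_right q.1).tendsto q.2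
  have heq : P.interpWith C q.1 =ᶠ[𝓝 q.2] fun w => ∑ a ∈ P.mesh.nodes P.p, C q.1 a *
      A.shape a (w - (A.coef q.1 * (inner ℝ A.e w + A.k)) • P.dx) := by
    filter_upwards [hc.eventually hq] with w hw
    exact Finset.sum_congr rfl fun a _ => by rw [hw a]
  have hg : HasGradientAt (fun w => ∑ a ∈ P.mesh.nodes P.p, C q.1 a *
      A.shape a (w - (A.coef q.1 * (inner ℝ A.e w + A.k)) • P.dx))
      (∑ a ∈ P.mesh.nodes P.p,
        C q.1 a • shearGradient (A.shape a) A.e P.dx A.k (A.coef q.1) q.2) q.2 := by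
    rw [hasGradientAt_iff_hasFDerivAt, map_sum]
    refine HasFDerivAt.fun_sum fun a _ => ?_
    have h := (hasGradientAt_shear ((A.contDiff a).differentiable (by simp)) A.e P.dx A.k
      (A.coef q.1) q.2).hasFDerivAt.const_mul (C q.1 a)
    rwa [map_smul]
  exact (hg.congr_of_eventuallyEq heq).gradient

/-- The derivative of the gradient of a finite-element function on the perturbed mesh along a
curve. -/
theorem hasDerivWithinAt_gradient_interpWith {K : NNReal} (hV : LipschitzWith K P.V)
    {C : ℝ → Plane → ℝ} {C' : Plane → ℝ} {S : Set ℝ} (h0S : (0 : ℝ) ∈ S)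
    (hC : ∀ a ∈ P.mesh.nodes P.p, HasDerivWithinAt (fun ε => C ε a) (C' a) S 0)
    {w : ℝ → Plane} {w' : Plane} (hw0 : w 0 = y) (hw : HasDerivWithinAt w w' S 0) :
    HasDerivWithinAt (fun ε => gradient (P.interpWith C ε) (w ε))
      (∑ a ∈ P.mesh.nodes P.p, (C' a • gradient (A.shape a) y +
        C 0 a • (fderiv ℝ (gradient (A.shape a)) y (w' - (inner ℝ A.e y + A.k) • P.dx) -
          (inner ℝ P.dx (gradient (A.shape a) y) : ℝ) • A.e))) S 0 := by
  have hcw : Tendsto (fun ε => (ε, w ε)) (𝓝[S] 0) (𝓝 ((0 : ℝ), y)) := by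
    have h := (continuousWithinAt_id (s := S) (x := (0 : ℝ))).prodMk hw.continuousWithinAt
    rw [ContinuousWithinAt, hw0] at h
    exact h
  have hev := hcw.eventually (A.eventually_gradient_interpWith hV C)
  refine HasDerivWithinAt.congr_of_eventuallyEq_of_mem ?_ hev h0S
  refine HasDerivWithinAt.fun_sum fun a ha => ?_
  have h1 := (hC a ha).smul (hasDerivWithinAt_shearGradient (A.contDiff a) A.e P.dx A.k
    A.coef_zero A.hasDerivAt_coef.hasDerivWithinAt hw)
  rw [hw0] at h1
  refine h1.congr_deriv ?_
  simp only [shearGradient, A.coef_zero, zero_mul, zero_smul, sub_zero]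
  rw [add_comm]

theorem eventually_gradient_ansatz :
    ∀ᶠ z in 𝓝 y, ∀ a, gradient (P.mesh.ansatz P.p a) z = gradient (A.shape a) z := by
  filter_upwards [A.eventually_ansatz.eventually_nhds] with z hz a
  have h : P.mesh.ansatz P.p a =ᶠ[𝓝 z] A.shape a := hz.mono fun w hw => hw a
  rw [gradient, gradient, h.fderiv_eq]

theorem hasGradientAt_sum_shape (c : Plane → ℝ) (z : Plane) :
    HasGradientAt (fun z => ∑ a ∈ P.mesh.nodes P.p, c a * A.shape a z)
      (∑ a ∈ P.mesh.nodes P.p, c a • gradient (A.shape a) z) z := by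
  rw [hasGradientAt_iff_hasFDerivAt, map_sum]
  refine HasFDerivAt.fun_sum fun a _ => ?_
  have h := (((A.contDiff a).differentiable (by simp)) z).hasGradientAt.hasFDerivAt.const_mul
    (c a)
  rwa [map_smul]

theorem gradient_sum (c : Plane → ℝ) :
    gradient (fun z => ∑ a ∈ P.mesh.nodes P.p, c a * P.mesh.ansatz P.p a z) y =
      ∑ a ∈ P.mesh.nodes P.p, c a • gradient (A.shape a) y := by
  have heq : (fun z => ∑ a ∈ P.mesh.nodes P.p, c a * P.mesh.ansatz P.p a z) =ᶠ[𝓝 y]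
      fun z => ∑ a ∈ P.mesh.nodes P.p, c a * A.shape a z := by
    filter_upwards [A.eventually_ansatz] with z hz
    exact Finset.sum_congr rfl fun a _ => by rw [hz a]
  exact ((A.hasGradientAt_sum_shape c y).congr_of_eventuallyEq heq).gradient

theorem hasFDerivAt_sum_gradient (c : Plane → ℝ) :
    HasFDerivAt (fun z => ∑ a ∈ P.mesh.nodes P.p, c a • gradient (P.mesh.ansatz P.p a) z)
      (∑ a ∈ P.mesh.nodes P.p, c a • fderiv ℝ (gradient (A.shape a)) y) y := by
  have heq : (fun z => ∑ a ∈ P.mesh.nodes P.p, c a • gradient (P.mesh.ansatz P.p a) z) =ᶠ[𝓝 y]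
      fun z => ∑ a ∈ P.mesh.nodes P.p, c a • gradient (A.shape a) z := by
    filter_upwards [A.eventually_gradient_ansatz] with z hz
    exact Finset.sum_congr rfl fun a _ => by rw [hz a]
  refine HasFDerivAt.congr_of_eventuallyEq (HasFDerivAt.fun_sum fun a _ => ?_) heq
  exact ((contDiff_gradient (A.contDiff a)).differentiable (by simp) y).hasFDerivAt.const_smul
    (c a)

theorem hasFDerivAt_gradient_interpWith_zero (C : ℝ → Plane → ℝ) :
    HasFDerivAt (gradient (P.interpWith C 0))
      (∑ a ∈ P.mesh.nodes P.p, C 0 a • fderiv ℝ (gradient (A.shape a)) y) y := by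
  refine (A.hasFDerivAt_sum_gradient (C 0)).congr_of_eventuallyEq ?_
  filter_upwards [A.eventually_ansatz.eventually_nhds] with z hz
  have heq : P.interpWith C 0 =ᶠ[𝓝 z] fun z => ∑ a ∈ P.mesh.nodes P.p, C 0 a * A.shape a z := by
    filter_upwards [hz] with v hv
    exact Finset.sum_congr rfl fun a _ => by rw [ansatzE_zero, hv a]
  rw [((A.hasGradientAt_sum_shape (C 0) z).congr_of_eventuallyEq heq).gradient]
  refine Finset.sum_congr rfl fun a _ => ?_
  have h : P.mesh.ansatz P.p a =ᶠ[𝓝 z] A.shape a := hz.mono fun w hw => hw a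
  rw [gradient, gradient, h.fderiv_eq]

theorem adjoint_fderiv_V (v : Plane) :
    ContinuousLinearMap.adjoint (fderiv ℝ P.V y) v = (inner ℝ P.dx v : ℝ) • A.e := by
  have h1 : HasFDerivAt (fun z : Plane => (inner ℝ A.e z + A.k) • P.dx)
      ((innerSL ℝ A.e).smulRight P.dx) y :=
    HasFDerivAt.smul_const (((innerSL ℝ A.e).hasFDerivAt (x := y)).add_const A.k) P.dx
  rw [(h1.congr_of_eventuallyEq A.eventually_V).fderiv]
  refine ext_inner_left ℝ fun u => ?_
  rw [ContinuousLinearMap.adjoint_inner_right, ContinuousLinearMap.smulRight_apply,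
    innerSL_apply_apply, real_inner_smul_left, real_inner_smul_right, real_inner_comm u, mul_comm]

theorem bracket_eq : P.bracket y = ∑ a ∈ P.mesh.nodes P.p, (P.dγ a • gradient (A.shape a) y +
    P.γ 0 a • (-(fderiv ℝ (gradient (A.shape a)) y ((inner ℝ A.e y + A.k) • P.dx)) -
      (inner ℝ P.dx (gradient (A.shape a) y) : ℝ) • A.e)) := by
  rw [bracket, A.gradient_sum, (A.hasFDerivAt_sum_gradient _).fderiv, A.adjoint_fderiv_V,
    A.eventually_V.self_of_nhds]
  simp only [A.eventually_gradient_ansatz.self_of_nhds, inner_sum, inner_smul_right,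
    Finset.sum_smul, _root_.sum_apply, _root_.smul_apply,
    ← Finset.sum_sub_distrib]
  refine Finset.sum_congr rfl fun a _ => ?_
  module

theorem hasShapeDeriv_gradient_interp (A : P.LocalForm y) {K : NNReal}
    (hV : LipschitzWith K P.V)
    (hγ : ∀ a ∈ P.mesh.nodes P.p,
      HasDerivWithinAt (fun ε => P.γ ε a) (P.dγ a) (Set.Ici 0) 0) :
    HasShapeDeriv P.V (fun ε => gradient (P.interp ε)) y (P.bracket y) := by
  rw [interp_eq]
  have hd := A.hasFDerivAt_gradient_interpWith_zero P.γ
  have hw : HasDerivWithinAt (fun ε : ℝ => y + ε • P.V y) (P.V y) (Set.Ici 0) 0 := by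
    simpa using ((hasDerivWithinAt_id (0 : ℝ) (Set.Ici 0)).smul_const (P.V y)).const_add y
  refine ⟨hd.differentiableAt, _, A.hasDerivWithinAt_gradient_interpWith hV Set.self_mem_Ici hγ
    (by simp) hw, ?_⟩
  rw [hd.fderiv, A.bracket_eq, _root_.sum_apply, ← Finset.sum_sub_distrib,
    A.eventually_V.self_of_nhds]
  refine Finset.sum_congr rfl fun a _ => ?_
  rw [sub_self, map_zero, _root_.smul_apply]
  module

/-- The derivative of the boundary force along a curve. -/
theorem hasDerivWithinAt_gradient_ρD (A : P.LocalForm y) {K : NNReal}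
    (hV : LipschitzWith K P.V)
    (hγ : ∀ a ∈ P.mesh.nodes P.p,
      HasDerivWithinAt (fun ε => P.γ ε a) (P.dγ a) (Set.Ici 0) 0)
    {w : ℝ → Plane} {w' : Plane} (hw0 : w 0 = y) (hw : HasDerivWithinAt w w' (Set.Ici 0) 0) :
    HasDerivWithinAt (fun ε => gradient (P.ρD ε) (w ε))
      (P.m • P.bracket y + fderiv ℝ (gradient (P.ρD 0)) y w') (Set.Ici 0) 0 := by
  rw [ρD_eq, (A.hasFDerivAt_gradient_interpWith_zero _).fderiv]
  refine (A.hasDerivWithinAt_gradient_interpWith hV (C' := fun a => P.m * P.dγ a)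
    Set.self_mem_Ici (fun a ha => ((hγ a ha).const_mul P.m).add_const _) hw0 hw).congr_deriv ?_
  rw [A.bracket_eq, Finset.smul_sum, _root_.sum_apply, ← Finset.sum_add_distrib]
  refine Finset.sum_congr rfl fun a _ => ?_
  rw [_root_.smul_apply, map_sub]
  have hL : (P.m * P.γL a) • (-(fderiv ℝ (gradient (A.shape a)) y
      ((inner ℝ A.e y + A.k) • P.dx)) -
      (inner ℝ P.dx (gradient (A.shape a) y) : ℝ) • A.e) = 0 := by
    rcases A.outflow with ⟨he, hk⟩ | h
    · simp [he, hk]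
    · rcases h a with h | h
      · simp [h]
      · have h1 : gradient (A.shape a) = fun _ => 0 := by
          funext z
          rw [h, gradient_fun_const]
        simp [h1]
  rw [← sub_eq_zero, ← hL]
  module

end LocalForm

end Setup

/-- A shortcut: instance search does not find this in reasonable time. -/
local instance continuousSMul_config (N : ℕ) : ContinuousSMul ℝ (Config N) :=
  IsBoundedSMul.continuousSMul

theorem sum_Icc_one_eq {M : Type*} [AddCommMonoid M] (f : ℕ → M) (n : ℕ) :
    ∑ k ∈ Finset.Icc 1 n, f k = ∑ k ∈ Finset.range n, f (k + 1) := by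
  induction n with
  | zero => simp
  | succ n ih => rw [Finset.sum_Icc_succ_top (by omega), ih, Finset.sum_range_succ]

theorem hasDerivWithinAt_toLp {N : ℕ} {f : ℝ → Fin N → Plane} {f' : Fin N → Plane} {S : Set ℝ}
    {t : ℝ} (h : ∀ i, HasDerivWithinAt (fun t => f t i) (f' i) S t) :
    HasDerivWithinAt (fun t => (WithLp.toLp 2 (f t) : Config N)) (WithLp.toLp 2 f') S t := by
  exact (PiLp.hasFDerivAt_toLp (𝕜 := ℝ) 2 (f t)).comp_hasDerivWithinAt t
    (hasDerivWithinAt_pi.2 h)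

theorem hasFDerivAt_toLp_comp {N : ℕ} {G : Plane → Plane} {D : Fin N → Plane →L[ℝ] Plane}
    {s : Config N × Config N} (h : ∀ i, HasFDerivAt G (D i) (s.2 i)) :
    ∃ L : Config N × Config N →L[ℝ] Config N,
      HasFDerivAt (fun s : Config N × Config N => (WithLp.toLp 2 fun i => G (s.2 i) : Config N))
        L s ∧ ∀ v, L v = WithLp.toLp 2 fun i => D i (v.2 i) := by
  let E := (PiLp.continuousLinearEquiv 2 ℝ (fun _ : Fin N => Plane)).symm.toContinuousLinearMap
  let R : Fin N → (Config N × Config N →L[ℝ] Plane) := fun i =>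
    (PiLp.proj 2 (fun _ : Fin N => Plane) i).comp (ContinuousLinearMap.snd ℝ _ _)
  refine ⟨E.comp (ContinuousLinearMap.pi fun i => (D i).comp (R i)), ?_, fun v => rfl⟩
  refine E.hasFDerivAt.comp s (hasFDerivAt_pi.2 fun i => ?_)
  exact HasFDerivAt.comp s (h i) (R i).hasFDerivAt

theorem contDiff_gaussKernel (h : ℝ) {n : WithTop ℕ∞} : ContDiff ℝ n (gaussKernel h) := by
  unfold gaussKernel
  have h1 : ContDiff ℝ n fun z : Plane => ‖z‖ ^ 2 := contDiff_norm_sq ℝ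
  exact contDiff_const.mul (h1.div_const _).neg.exp

namespace Setup

variable {N : ℕ} (P : Setup N)

theorem exists_cost_eq (hshore : ∀ y ∈ P.shore, P.V y = 0)
    {J : ℝ → Config N → Config N → ℝ} (hJ : J = P.densityCost ∨ J = P.particleCost) :
    ∃ j : Config N → ℝ, Differentiable ℝ j ∧ ∀ ε u x, J ε u x = j x := by
  have hφ : ∀ ε, ∀ y ∈ P.shore, P.φ ε y = y := fun ε y hy => by simp [φ, hshore y hy]
  have hk : ∀ (y : Plane) (i : Fin N),
      Differentiable ℝ fun x : Config N => gaussKernel P.h (y - x i) := fun y i =>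
    ((contDiff_gaussKernel P.h (n := 1)).differentiable (by simp)).comp
      ((differentiable_const y).sub (PiLp.proj 2 (fun _ : Fin N => Plane) i).differentiable)
  rcases hJ with rfl | rfl
  · refine ⟨P.densityCost 0 0, ?_, fun ε u x => ?_⟩
    · unfold densityCost
      fun_prop
    · exact Finset.sum_congr rfl fun y hy => by rw [hφ ε y hy, hφ 0 y hy]
  · refine ⟨P.particleCost 0 0, ?_, fun ε u x => ?_⟩
    · unfold particleCost
      fun_prop
    · exact Finset.sum_congr rfl fun y hy => by rw [hφ ε y hy, hφ 0 y hy]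

/-- The brackets at all particles. -/
noncomputable def bracketConfig (x : Config N) : Config N :=
  WithLp.toLp 2 fun i => P.bracket (x i)

theorem shapeSum_eq (μ δ : ℕ → Config N) :
    P.shapeSum μ δ = ∑ k ∈ Finset.range P.n,
      inner ℝ (P.bracketConfig (P.x k)) (P.dt • μ (k + 1) + P.dt ^ 2 • δ (k + 1)) := by
  rw [shapeSum, sum_Icc_one_eq]
  rfl

/-- The force depends differentiably on the states and on the deformation. -/
theorem hasDerivWithinAt_F {K : NNReal} (hV : LipschitzWith K P.V)
    (hγ : ∀ a ∈ P.mesh.nodes P.p, HasDerivWithinAt (fun ε => P.γ ε a) (P.dγ a) (Set.Ici 0) 0)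
    {s : Config N × Config N}
    (hF : DifferentiableAt ℝ (fun s : Config N × Config N => P.Ffluid s.1 s.2) s)
    (A : ∀ i, P.LocalForm (s.2 i)) :
    DifferentiableAt ℝ (fun s : Config N × Config N => P.F 0 s.1 s.2) s ∧
    ∀ {z : ℝ → Config N × Config N} {z' : Config N × Config N}, z 0 = s →
      HasDerivWithinAt z z' (Set.Ici 0) 0 →
      HasDerivWithinAt (fun ε => P.F ε (z ε).1 (z ε).2)
        (P.m • P.bracketConfig s.2 +
          fderiv ℝ (fun s : Config N × Config N => P.F 0 s.1 s.2) s z') (Set.Ici 0) 0 := by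
  have hFeq : ∀ ε (s : Config N × Config N), P.F ε s.1 s.2 =
      P.Ffluid s.1 s.2 + WithLp.toLp 2 fun i => gradient (P.ρD ε) (s.2 i) := fun ε s => rfl
  have hρ : ∀ i, HasFDerivAt (gradient (P.ρD 0)) (fderiv ℝ (gradient (P.ρD 0)) (s.2 i))
      (s.2 i) := fun i => by
    rw [ρD_eq]
    exact ((A i).hasFDerivAt_gradient_interpWith_zero _).differentiableAt.hasFDerivAt
  obtain ⟨L, hL, hLv⟩ := hasFDerivAt_toLp_comp hρ
  have hF0 : HasFDerivAt (fun s : Config N × Config N => P.F 0 s.1 s.2)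
      (fderiv ℝ (fun s : Config N × Config N => P.Ffluid s.1 s.2) s + L) s :=
    hF.hasFDerivAt.fun_add hL
  refine ⟨hF0.differentiableAt, ?_⟩
  rintro z z' rfl hz
  rw [hF0.fderiv]
  have h1 : HasDerivWithinAt (fun ε => P.Ffluid (z ε).1 (z ε).2)
      (fderiv ℝ (fun s : Config N × Config N => P.Ffluid s.1 s.2) (z 0) z') (Set.Ici 0) 0 :=
    hF.hasFDerivAt.comp_hasDerivWithinAt (0 : ℝ) hz
  have h2 : HasDerivWithinAt
      (fun ε => (WithLp.toLp 2 fun i => gradient (P.ρD ε) ((z ε).2 i) : Config N))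
      (WithLp.toLp 2 fun i => P.m • P.bracket ((z 0).2 i) +
        fderiv ℝ (gradient (P.ρD 0)) ((z 0).2 i) (z'.2 i)) (Set.Ici 0) 0 := by
    refine hasDerivWithinAt_toLp fun i => ?_
    refine (A i).hasDerivWithinAt_gradient_ρD hV hγ (w := fun ε => (z ε).2 i) rfl ?_
    exact ((PiLp.proj 2 (fun _ : Fin N => Plane) i).comp
      (ContinuousLinearMap.snd ℝ (Config N) (Config N))).hasFDerivAt.comp_hasDerivWithinAt
        (0 : ℝ) hz
  refine (h1.fun_add h2).congr_deriv ?_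
  rw [_root_.add_apply, hLv, add_left_comm]
  rfl

/-- The derivative of the force on the unperturbed domain with respect to the states. -/
noncomputable def stateDeriv (k : ℕ) : Config N × Config N →L[ℝ] Config N :=
  fderiv ℝ (fun s : Config N × Config N => P.F 0 s.1 s.2) (P.u k, P.x k)

/-- The linearization of the particle system with respect to the deformation. -/
noncomputable def tangent : ℕ → Config N × Config N
  | 0 => 0
  | k + 1 =>
    let u' := (tangent k).1 + (P.dt / P.m) •
      (P.m • P.bracketConfig (P.x k) + P.stateDeriv k (tangent k))
    (u', (tangent k).2 + P.dt • u')

theorem hasDerivWithinAt_traj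
    (hstep : ∀ k < P.n, ∀ {z : ℝ → Config N × Config N} {z' : Config N × Config N},
      z 0 = (P.u k, P.x k) → HasDerivWithinAt z z' (Set.Ici 0) 0 →
      HasDerivWithinAt (fun ε => P.F ε (z ε).1 (z ε).2)
        (P.m • P.bracketConfig (P.x k) + P.stateDeriv k z') (Set.Ici 0) 0)
    {k : ℕ} (hk : k ≤ P.n) :
    HasDerivWithinAt (fun ε => P.traj ε k) (P.tangent k) (Set.Ici 0) 0 := by
  induction k with
  | zero => exact hasDerivWithinAt_const _ _ _
  | succ k ih =>
    have hz := ih (by omega)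
    have hF := hstep k hk rfl hz
    have hz1 : HasDerivWithinAt (fun ε => (P.traj ε k).1) (P.tangent k).1 (Set.Ici 0) 0 :=
      (ContinuousLinearMap.fst ℝ (Config N) (Config N)).hasFDerivAt.comp_hasDerivWithinAt
        (0 : ℝ) hz
    have hz2 : HasDerivWithinAt (fun ε => (P.traj ε k).2) (P.tangent k).2 (Set.Ici 0) 0 :=
      (ContinuousLinearMap.snd ℝ (Config N) (Config N)).hasFDerivAt.comp_hasDerivWithinAt
        (0 : ℝ) hz
    have hu := hz1.fun_add (hF.fun_const_smul (P.dt / P.m))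
    exact hu.prodMk (hz2.fun_add (hu.fun_const_smul P.dt))

/-- The derivative of the objective, from the linearized particle system. -/
theorem hasDerivWithinAt_objective
    (hstep : ∀ k < P.n, ∀ {z : ℝ → Config N × Config N} {z' : Config N × Config N},
      z 0 = (P.u k, P.x k) → HasDerivWithinAt z z' (Set.Ici 0) 0 →
      HasDerivWithinAt (fun ε => P.F ε (z ε).1 (z ε).2)
        (P.m • P.bracketConfig (P.x k) + P.stateDeriv k z') (Set.Ici 0) 0)
    {J : ℝ → Config N → Config N → ℝ} {j : Config N → ℝ} (hjd : Differentiable ℝ j)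
    (hj : ∀ ε u x, J ε u x = j x) :
    HasDerivWithinAt (P.objective J) (∑ k ∈ Finset.range P.n,
      inner ℝ (gradient j (P.x (k + 1))) (P.tangent (k + 1)).2) (Set.Ici 0) 0 := by
  have hobj : P.objective J = fun ε => ∑ k ∈ Finset.range P.n, j (P.traj ε (k + 1)).2 := by
    funext ε
    rw [objective, sum_Icc_one_eq]
    simp only [hj]
  rw [hobj]
  refine HasDerivWithinAt.fun_sum fun k hk => ?_
  have htraj := P.hasDerivWithinAt_traj hstep (Nat.succ_le_of_lt (Finset.mem_range.1 hk))
  have hx : HasDerivWithinAt (fun ε => (P.traj ε (k + 1)).2) (P.tangent (k + 1)).2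
      (Set.Ici 0) 0 :=
    (ContinuousLinearMap.snd ℝ (Config N) (Config N)).hasFDerivAt.comp_hasDerivWithinAt
      (0 : ℝ) htraj
  exact (hjd (P.x (k + 1))).hasGradientAt.hasFDerivAt.comp_hasDerivWithinAt (0 : ℝ) hx

/-- Summation by parts with the adjoint sequences. -/
theorem sum_inner_gradient_tangent (hm : P.m ≠ 0)
    (hdiff : ∀ k < P.n, DifferentiableAt ℝ (fun s : Config N × Config N => P.F 0 s.1 s.2)
      (P.u k, P.x k))
    {J : ℝ → Config N → Config N → ℝ} {j : Config N → ℝ} (hj : ∀ ε u x, J ε u x = j x)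
    {μ δ : ℕ → Config N} (hadj : P.IsAdjoint J μ δ) :
    ∑ k ∈ Finset.range P.n, inner ℝ (gradient j (P.x (k + 1))) (P.tangent (k + 1)).2 =
      P.shapeSum μ δ := by
  rw [P.shapeSum_eq]
  have hJu : ∀ x : Config N, (fun w => J 0 w x) = fun _ => j x := fun x =>
    funext fun w => hj 0 w x
  have hJx : ∀ u : Config N, (fun z => J 0 u z) = j := fun u => funext fun z => hj 0 u z
  set f : ℕ → ℝ := fun k =>
    inner ℝ (P.bracketConfig (P.x k)) (P.dt • μ (k + 1) + P.dt ^ 2 • δ (k + 1))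
  set g : ℕ → ℝ := fun k => inner ℝ (gradient j (P.x k)) (P.tangent k).2
  set S : ℕ → ℝ := fun k => inner ℝ (μ k) (P.tangent k).1 + inner ℝ (δ k) (P.tangent k).2
  have hstep : ∀ k, S (k + 1) = f k +
      (inner ℝ (μ (k + 1) + P.dt • δ (k + 1))
        ((P.tangent k).1 + (P.dt / P.m) • P.stateDeriv k (P.tangent k)) +
      inner ℝ (δ (k + 1)) (P.tangent k).2) := by
    intro k
    simp only [S, f, tangent, smul_add, smul_smul, inner_add_left, inner_add_right,
      real_inner_smul_left, real_inner_smul_right]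
    rw [real_inner_comm (P.bracketConfig (P.x k)) (μ (k + 1)),
      real_inner_comm (P.bracketConfig (P.x k)) (δ (k + 1))]
    field_simp
    ring
  have hback : ∀ k, 1 ≤ k → k < P.n → S k = g k +
      (inner ℝ (μ (k + 1) + P.dt • δ (k + 1))
        ((P.tangent k).1 + (P.dt / P.m) • P.stateDeriv k (P.tangent k)) +
      inner ℝ (δ (k + 1)) (P.tangent k).2) := by
    intro k h1 hk
    have hD := (hdiff k hk).hasFDerivAt
    have hu : HasFDerivAt (fun w => P.F 0 w (P.x k))
        ((P.stateDeriv k).comp (ContinuousLinearMap.inl ℝ (Config N) (Config N))) (P.u k) :=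
      hD.comp (f := fun w => (w, P.x k)) (P.u k) (hasFDerivAt_prodMk_left (P.u k) (P.x k))
    have hx : HasFDerivAt (fun z => P.F 0 (P.u k) z)
        ((P.stateDeriv k).comp (ContinuousLinearMap.inr ℝ (Config N) (Config N))) (P.x k) :=
      hD.comp (f := fun z => (P.u k, z)) (P.x k) (hasFDerivAt_prodMk_right (P.u k) (P.x k))
    have hsplit : P.stateDeriv k (P.tangent k) =
        P.stateDeriv k ((P.tangent k).1, 0) + P.stateDeriv k (0, (P.tangent k).2) := by
      rw [← map_add]
      simp
    simp only [S, g]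
    rw [hadj.μ_step k h1 hk, hadj.δ_step k h1 hk, hu.fderiv, hx.fderiv, hJu, hJx, hsplit,
      gradient_fun_const, add_zero]
    simp only [inner_add_left, real_inner_smul_left, ContinuousLinearMap.adjoint_inner_left,
      ContinuousLinearMap.comp_apply, ContinuousLinearMap.inl_apply,
      ContinuousLinearMap.inr_apply, inner_add_right, real_inner_smul_right]
    ring
  have hsum : ∀ k, k + 1 ≤ P.n →
      S (k + 1) + ∑ l ∈ Finset.range k, g (l + 1) = ∑ l ∈ Finset.range (k + 1), f l := by
    intro k
    induction k with
    | zero =>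
      intro _
      rw [hstep 0]
      simp [tangent]
    | succ k ih =>
      intro hk
      rw [Finset.sum_range_succ f, ← ih (by omega), hback (k + 1) (by omega) (by omega),
        hstep (k + 1), Finset.sum_range_succ]
      ring
  rcases hn : P.n with _ | n
  · simp
  · have hlast : S (n + 1) = g (n + 1) := by
      have h1 := hadj.μ_last
      have h2 := hadj.δ_last
      rw [hn, hJu, gradient_fun_const] at h1
      rw [hn, hJx] at h2
      simp only [S, g]
      rw [h1, h2, inner_zero_left, zero_add]
    rw [← hsum n (by omega), hlast, Finset.sum_range_succ, add_comm]

end Setup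

end SPHShape

theorem theorem2 {N : ℕ} (P : SPHShape.Setup N)
    (hm : 0 < P.m) (hdt : 0 < P.dt) (hh : 0 < P.h) (hα : 0 < P.α) (hρ : 0 < P.ρ₀) (hp : 1 ≤ P.p)
    (hΩ : IsOpen P.Ω)
    -- the perturbed vertex is a mesh vertex, and its hat function, extended by zero, is continuous
    -- (that is, the vertex does not lie on the outer boundary of the mesh)
    (hvtx : P.vtx ∈ P.mesh.vertices) (hcont : Continuous (P.mesh.ansatz 1 P.vtx))
    -- the shoreline is fixed
    (hshore : ∀ y ∈ P.shore, P.V y = 0)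
    -- the outflow layer does not meet the triangles around the perturbed vertex
    (hout : ∀ c ∈ P.mesh.cells, P.vtx ∈ Set.range c →
      ∀ β ∈ SPHShape.multiIdx P.p, P.γL (SPHShape.localNode P.p c β) = 0)
    -- the fluid force is differentiable at the states of the particle system
    (hF : ∀ k < P.n, DifferentiableAt ℝ
      (fun s : SPHShape.Config N × SPHShape.Config N => P.Ffluid s.1 s.2) (P.u k, P.x k))
    -- no particle lies on an edge of the mesh, where the ansatz functions have no gradient
    (hpart : ∀ k < P.n, ∀ i, ∀ c ∈ P.mesh.cells, P.x k i ∉ frontier (SPHShape.hull c))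
    (hnode : ∀ a ∈ P.mesh.nodes P.p, P.Regular a)
    (J : ℝ → SPHShape.Config N → SPHShape.Config N → ℝ)
    (hJ : J = P.densityCost ∨ J = P.particleCost)
    (μ δ : ℕ → SPHShape.Config N) (hadj : P.IsAdjoint J μ δ) :
    -- the shape derivative of the objective, and its value
    HasDerivWithinAt (P.objective J) (P.shapeSum μ δ) (Set.Ici 0) 0 ∧
    -- it is the sum of the following two derivatives, of which the first vanishes
    HasDerivWithinAt (fun ε => ∑ k ∈ Finset.Icc 1 P.n, J ε (P.u k) (P.x k)) 0 (Set.Ici 0) 0 ∧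
    HasDerivWithinAt (fun ε => ∑ k ∈ Finset.Icc 1 P.n,
        inner ℝ (P.F ε (P.u (k - 1)) (P.x (k - 1)))
          ((P.dt / P.m) • μ k + (P.dt ^ 2 / P.m) • δ k))
      (P.shapeSum μ δ) (Set.Ici 0) 0 ∧
    -- each bracket is the shape derivative of the gradient of the interpolant at the particle,
    -- from the material derivative along the particle position moved with the deformation
    (∀ k < P.n, ∀ i, SPHShape.HasShapeDeriv P.V (fun ε => gradient (P.interp ε)) (P.x k i)
      (P.bracket (P.x k i))) ∧
    -- the shape derivative of the smoothed boundary term, in particular at the nodes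
    (∀ y, P.Regular y → HasDerivWithinAt (fun ε => P.γ ε y) (P.dγ y) (Set.Ici 0) 0) := by
  obtain ⟨K, hV⟩ := P.exists_lipschitzWith_V hcont
  have hγ : ∀ y, P.Regular y →
      HasDerivWithinAt (fun ε => P.γ ε y) (P.dγ y) (Set.Ici 0) 0 := fun y hy =>
    P.hasDerivWithinAt_γ hcont hh hα hΩ hy
  have hγn : ∀ a ∈ P.mesh.nodes P.p,
      HasDerivWithinAt (fun ε => P.γ ε a) (P.dγ a) (Set.Ici 0) 0 := fun a ha => hγ a (hnode a ha)
  have A : ∀ k < P.n, ∀ i, Nonempty (P.LocalForm (P.x k i)) := fun k hk i =>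
    P.nonempty_localForm hout (hpart k hk i)
  have hforce := fun k hk => P.hasDerivWithinAt_F hV hγn (hF k hk) fun i => (A k hk i).some
  obtain ⟨j, hjd, hj⟩ := P.exists_cost_eq hshore hJ
  refine ⟨?_, ?_, ?_, fun k hk i => (A k hk i).some.hasShapeDeriv_gradient_interp hV hγn, hγ⟩
  · rw [← P.sum_inner_gradient_tangent hm.ne' (fun k hk => (hforce k hk).1) hj hadj]
    exact P.hasDerivWithinAt_objective (fun k hk => (hforce k hk).2) hjd hj
  · simp only [hj]
    exact hasDerivWithinAt_const _ _ _
  · rw [P.shapeSum_eq]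
    simp only [SPHShape.sum_Icc_one_eq, Nat.add_sub_cancel]
    refine HasDerivWithinAt.fun_sum fun k hk => ?_
    have h := (hforce k (Finset.mem_range.1 hk)).2 (z := fun _ => (P.u k, P.x k)) rfl
      (hasDerivWithinAt_const _ _ _)
    refine (h.inner ℝ (hasDerivWithinAt_const (0 : ℝ) (Set.Ici 0) _)).congr_deriv ?_
    rw [inner_zero_right, zero_add, map_zero, add_zero]
    simp only [real_inner_smul_left, inner_add_right, real_inner_smul_right]
    field_simp
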